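/- **Setting.** In each of $N\ge 1$ rounds Alice chooses a uniform bit $a\in\{0,1\}$, a basis $\alpha\in\{Z,X\}$ with probability $p_\alpha>0$ ($p_Z+p_X=1$) and an intensity label $\omega\in\{S,D,V\}$ with probability $p_\omega>0$ ($p_S+p_D+p_V=1$), and emits a phase-randomized coherent pulse of mean photon number $\mu_\omega$ ($\mu_V=0<\mu_D<\mu_S$) whose polarization $\phi(a,\alpha)$ is horizontal, vertical, diagonal, anti-diagonal for $(a,\alpha)=(0,Z),(1,Z),(0,X),(1,X)$. Put $p^{\rm int}_\omega(n)=e^{-\mu_\omega}\mu_\omega^n/n!$ and $p^{\rm int}(n)=\sum_\omega p_\omega p^{\rm int}_\omega(n)$. An eavesdropper may apply an arbitrary joint quantum operation to the $N$ pulses (two polarization modes each) before Bob receives them. Bob's receiver consists of a beam splitter of transmittance $q\in(0,\tfrac12)$, transmitted light going to the $X$ line and reflected light to the $Z$ line, and of two threshold detectors per line, all with efficiency $\eta_{\rm det}\in(0,1]$ and dark count probability $d\in[0,1)$. He sets $\beta=Z$ or $\beta=X$ if there are detections on the $Z$ line only or on the $X$ line only; his bit is that of the detector that clicked, or a random bit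 if both detectors of that line clicked. Detections on both lines are a cross-click. In the virtual protocol Alice prepares, in each round, the purified state $$\sum_{a,\omega,n,\alpha}\sqrt{p_\omega p^{\rm int}_\omega(n)p_\alpha/2}\;|a\rangle|\omega\rangle|n\rangle|\alpha\rangle|n_{\phi(a,\alpha)}\rangle,$$ where $|n_{\phi}\rangle$ is the state of $n$ photons with polarization $\phi$. She sends the last system and measures $\omega,n,\alpha$; she measures the qubit $|a\rangle$ in the basis $\{|0\rangle,|1\rangle\}$ if $\alpha=X$ and in the basis $\{|+\rangle,|-\rangle\}$ if $\alpha=Z$. Bob measures diagonal / anti-diagonal polarization on both lines; the detection efficiency is represented by a beam splitter of transmittance $\eta_{\rm det}$ in front of his receiver. Let $N^1_{\rm ph}$ be the number of rounds with $\alpha=\beta=Z$ and $n=1$ in which these outcomes of Alice and Bob differ (identifying $+,-$ with the bits $0,1$, and diagonal, anti-diagonal with the bits $0,1$). Let $N^{\rm Error}_{X,\omega}$ be the number of rounds with $\alpha=\beta=X$ and label $\omega$ in which the bits of Alice and Bob differ, and $N^{\rm Cross}_\omega$ the number of cross-clicks with label $\omega$. **Deviation terms.** For $0<\epsilon<1$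 and $0\le C\le N$ put $$a_{\rm U}(N,C,\epsilon)=\frac{216\sqrt N\,C(N-C)\ln\epsilon-48N^{3/2}(\ln\epsilon)^2+27\sqrt2\,(N-2C)\sqrt{-N^2\ln\epsilon\,[9C(N-C)-2N\ln\epsilon]}}{4(9N-8\ln\epsilon)[9C(N-C)-2N\ln\epsilon]},$$ $$a_{\rm L}(N,C,\epsilon)=\frac{-216\sqrt N\,C(N-C)\ln\epsilon+48N^{3/2}(\ln\epsilon)^2+27\sqrt2\,(N-2C)\sqrt{-N^2\ln\epsilon\,[9C(N-C)-2N\ln\epsilon]}}{4(9N-8\ln\epsilon)[9C(N-C)-2N\ln\epsilon]},$$ $$b_{\rm U}=\sqrt{a_{\rm U}^2+\tfrac12\Big(1+\tfrac{4a_{\rm U}}{\sqrt{9N}}\Big)^2\ln\tfrac1\epsilon},\qquad b_{\rm L}=\sqrt{a_{\rm L}^2+\tfrac12\Big(1-\tfrac{4a_{\rm L}}{\sqrt{9N}}\Big)^2\ln\tfrac1\epsilon},$$ and, for $\bullet\in\{{\rm U},{\rm L}\}$, $$\Delta_\bullet(M,C)=\frac{b_\bullet(N,C,\epsilon)\,N+a_\bullet(N,C,\epsilon)\,(2M-N)}{\sqrt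 N}.$$ **Theorem.** Let $0<\epsilon<1$, and let $\tilde N^1_{\rm ph},\tilde N^{\rm Error}_{X,\omega},\tilde N^{\rm Cross}_\omega\in[0,N]$ be constants fixed in advance (estimates of the corresponding counts). Let $$c_1=\frac{1-q}{q}\,\frac{p_Z}{p_X},\qquad c_2=\frac{p_Z(1-q)(1-2q)(1-d)^2}{1-(q^2+(1-q)^2)(1-d)^2};$$ these are nonnegative. Write $a_{\rm L}$ and $b_{\rm L}$ for their values at $(N,\tilde N^1_{\rm ph},\epsilon)$ and put $$T_{\rm Error}=\frac{e^{\mu_D}\big(N^{\rm Error}_{X,D}+\Delta_{\rm U}(N^{\rm Error}_{X,D},\tilde N^{\rm Error}_{X,D})\big)}{p_D}-\frac{N^{\rm Error}_{X,V}-\Delta_{\rm L}(N^{\rm Error}_{X,V},\tilde N^{\rm Error}_{X,V})}{p_V},$$ $$T_{\rm Cross}=\frac{e^{\mu_D}\big(N^{\rm Cross}_{D}+\Delta_{\rm U}(N^{\rm Cross}_{D},\tilde N^{\rm Cross}_{D})\big)}{p_D}-\frac{N^{\rm Cross}_{V}-\Delta_{\rm L}(N^{\rm Cross}_{V},\tilde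 N^{\rm Cross}_{V})}{p_V}.$$ Define $$N^{1,{\rm U}}_{\rm ph}=\Big(1-\frac{2a_{\rm L}}{\sqrt N}\Big)^{-1}\Big\{\frac{p^{\rm int}(1)}{\mu_D}\big[c_1T_{\rm Error}+c_2T_{\rm Cross}\big]+(b_{\rm L}-a_{\rm L})\sqrt N\Big\}\quad\text{if } a_{\rm L}<\sqrt N/2,$$ and $N^{1,{\rm U}}_{\rm ph}=N$ if $a_{\rm L}\ge\sqrt N/2$ (the trivial bound). Then, for every attack of the eavesdropper, $N^1_{\rm ph}\le N^{1,{\rm U}}_{\rm ph}$ holds except with probability at most $5\epsilon$. Moreover, if $a_{\rm L}<\sqrt N/2$, then $N^{1,{\rm U}}_{\rm ph}$ differs from the bound for active basis choice, which is the same closed form without the term $c_2T_{\rm Cross}$, exactly by the cross-click term $\big(1-\frac{2a_{\rm L}}{\sqrt N}\big)^{-1}\frac{p^{\rm int}(1)}{\mu_D}\,c_2T_{\rm Cross}$. -/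

import Mathlib

open scoped BigOperators ENNReal

noncomputable section

namespace PassiveBB84

/-! ### Labels and parameters -/

/-- Polarization bases; also used to name the two lines of the receiver. -/
inductive BasisLabel
  | Z
  | X
  deriving DecidableEq

instance : Fintype BasisLabel := ⟨{BasisLabel.Z, BasisLabel.X}, fun a => by cases a <;> simp⟩

/-- Intensity labels: signal, decoy, vacuum. -/
inductive Intensity
  | S
  | D
  | V
  deriving DecidableEq

instance : Fintype Intensity :=
  ⟨{Intensity.S, Intensity.D, Intensity.V}, fun a => by cases a <;> simp⟩

open BasisLabel Intensity

/-- The parameters of the source and of the receiver, with the assumptions made on them. -/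
structure Params where
  /-- probability of the intensity label `ω` -/
  pInten : Intensity → ℝ
  pInten_pos : ∀ ω, 0 < pInten ω
  pInten_sum : pInten S + pInten D + pInten V = 1
  /-- probability of Alice's basis `α` -/
  pBasis : BasisLabel → ℝ
  pBasis_pos : ∀ α, 0 < pBasis α
  pBasis_sum : pBasis Z + pBasis X = 1
  /-- mean photon number of the intensity label `ω` -/
  mu : Intensity → ℝ
  mu_V : mu V = 0
  mu_D_pos : 0 < mu D
  mu_D_lt : mu D < mu S
  /-- transmittance of Bob's beam splitter; transmitted light goes to the `X` line -/
  q : ℝ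
  q_pos : 0 < q
  q_lt : q < 1 / 2
  /-- common efficiency of the four threshold detectors -/
  eta : ℝ
  eta_pos : 0 < eta
  eta_le : eta ≤ 1
  /-- common dark count probability of the four threshold detectors -/
  d : ℝ
  d_nonneg : 0 ≤ d
  d_lt : d < 1

namespace Params

/-- Poissonian probability of emitting `n` photons given the intensity label `ω`. -/
def pPhoton (P : Params) (ω : Intensity) (n : ℕ) : ℝ :=
  Real.exp (-P.mu ω) * P.mu ω ^ n / (n.factorial : ℝ)

/-- Probability of emitting `n` photons in a round. -/
def pPhotonAvg (P : Params) (n : ℕ) : ℝ :=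
  ∑ ω : Intensity, P.pInten ω * P.pPhoton ω n

/-- `c₁ = ((1 - q) / q) (p_Z / p_X)` -/
def c₁ (P : Params) : ℝ := (1 - P.q) / P.q * (P.pBasis Z / P.pBasis X)

/-- `c₂`, the coefficient of the cross-click counts -/
def c₂ (P : Params) : ℝ :=
  P.pBasis Z * (1 - P.q) * (1 - 2 * P.q) * (1 - P.d) ^ 2 /
    (1 - (P.q ^ 2 + (1 - P.q) ^ 2) * (1 - P.d) ^ 2)

end Params

/-! ### Alice's source

A pulse consists of two polarization modes. Its Hilbert space is `ℓ²(ℕ × ℕ)`; the basis vector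
with label `(k, l)` is the number state with `k` horizontal and `l` vertical photons. -/

/-- The polarization `φ(a, α)` as a unit vector in the horizontal / vertical basis: horizontal,
vertical, diagonal, anti-diagonal for `(0,Z)`, `(1,Z)`, `(0,X)`, `(1,X)`. -/
def polarization : BasisLabel → Bool → ℝ × ℝ
  | Z, false => (1, 0)
  | Z, true => (0, 1)
  | X, false => (1 / √2, 1 / √2)
  | X, true => (1 / √2, -(1 / √2))

/-- Amplitude of the number state `(k, l)` in the `n`-photon state with polarization `v`, i.e.
in `(v₁ a_H† + v₂ a_V†)ⁿ |vac⟩ / √n!`. -/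
def numberAmp (v : ℝ × ℝ) (n : ℕ) (k : ℕ × ℕ) : ℝ :=
  if k.1 + k.2 = n then √(n.choose k.1 : ℝ) * v.1 ^ k.1 * v.2 ^ k.2 else 0

/-- What Alice obtains in one round of the virtual protocol: basis `α`, intensity label `ω`,
photon number `n`, and the outcome of her measurement of the bit qubit. -/
structure AliceRecord where
  basis : BasisLabel
  inten : Intensity
  photons : ℕ
  bit : Bool

/-- `⟨s|a⟩` for Alice's measurement of the bit qubit: for `α = X` she reads the bit `a`, for
`α = Z` she measures in the complementary basis (`false` is `+`, `true` is `-`). -/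
def bitOverlap : BasisLabel → Bool → Bool → ℝ
  | X, s, a => if s = a then 1 else 0
  | Z, s, a => if s && a then -(1 / √2) else 1 / √2

/-- Amplitude at the number state `k` of the (unnormalized) state of the emitted pulse that is left
when Alice obtains the record `r` from the purified state
`∑ √(p_ω p_ω(n) p_α / 2) |a⟩ |ω⟩ |n⟩ |α⟩ |n_φ(a,α)⟩`; its squared norm is the probability of `r`. -/
def emitAmp (P : Params) (r : AliceRecord) (k : ℕ × ℕ) : ℝ :=
  ∑ a : Bool, bitOverlap r.basis r.bit a *
    √(P.pInten r.inten * P.pPhoton r.inten r.photons * P.pBasis r.basis / 2) *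
    numberAmp (polarization r.basis a) r.photons k

/-- The Hilbert space of `N` pulses together with a further system `K`:
`ℓ²((ℕ × ℕ)^N) ⊗ K`, realized as the square summable families in `K`. -/
abbrev Pulses (N : ℕ) (K : Type*) [NormedAddCommGroup K] :=
  lp (fun _ : Fin N → ℕ × ℕ => K) 2

/-- The (unnormalized) state of the `N` emitted pulses given Alice's records: the product of the
states of the rounds. -/
def emitted (P : Params) {N : ℕ} (x : Fin N → AliceRecord) : Pulses N ℂ :=
  ∑ k ∈ Fintype.piFinset (fun i => Finset.HasAntidiagonal.antidiagonal (x i).photons),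
    lp.single 2 k (((∏ i, emitAmp P (x i) (k i) : ℝ)) : ℂ)

/-! ### Eve's attack and Bob's receiver

Eve acts jointly on all `N` pulses. By Stinespring's theorem her action is an isometry from the `N`
emitted pulses to the `N` pulses received by Bob and a system `K` that she keeps. -/

/-- A coherent attack on `N` pulses; Eve keeps the system `K`. -/
abbrev Attack (N : ℕ) (K : Type*) [NormedAddCommGroup K] [InnerProductSpace ℂ K] :=
  Pulses N ℂ →ₗᵢ[ℂ] Pulses N K

/-- Where the photons of one received polarization mode end up: lost (finite detection efficiency),
on the `Z` line, on the `X` line. -/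
structure Ports where
  lost : ℕ
  onZ : ℕ
  onX : ℕ

/-- The number of photons of the mode before the losses. -/
def Ports.total (p : Ports) : ℕ := p.lost + (p.onZ + p.onX)

/-- What happens at Bob's receiver in one round of the virtual protocol. The received pulse is
described in the number basis of its diagonal and anti-diagonal modes, which are led to the
detectors for bit `0` and bit `1` on both lines, as both lines measure in the `X` basis. -/
structure BobRecord where
  /-- photons of the diagonal mode -/
  diag : Ports
  /-- photons of the anti-diagonal mode -/
  anti : Ports
  /-- whether the detector for the bit `b` on the given line has a dark count -/
  dark : BasisLabel → Bool → Bool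
  /-- the random bit used when both detectors of one line click -/
  coin : Bool

namespace BobRecord

/-- Photon numbers of the two modes (diagonal, anti-diagonal) of the received pulse. -/
def incoming (y : BobRecord) : ℕ × ℕ := (y.diag.total, y.anti.total)

/-- Number of photons that reach the detector for the bit `b` on the line `ℓ`. -/
def photonsAt (y : BobRecord) : BasisLabel → Bool → ℕ
  | Z, false => y.diag.onZ
  | Z, true => y.anti.onZ
  | X, false => y.diag.onX
  | X, true => y.anti.onX

/-- A threshold detector clicks if a photon arrives or if there is a dark count. -/
def clicks (y : BobRecord) (ℓ : BasisLabel) (b : Bool) : Bool :=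
  decide (0 < y.photonsAt ℓ b) || y.dark ℓ b

/-- There is a detection on the line `ℓ`. -/
def lineClicks (y : BobRecord) (ℓ : BasisLabel) : Bool := y.clicks ℓ false || y.clicks ℓ true

/-- The bit read on the line `ℓ` (where there is a detection): the detector that clicked, or a
random bit if both did. -/
def bitOn (y : BobRecord) (ℓ : BasisLabel) : Bool :=
  if y.clicks ℓ false && y.clicks ℓ true then y.coin else y.clicks ℓ true

/-- Bob's basis `β`: the line with a detection if there is exactly one such line. -/
def beta (y : BobRecord) : Option BasisLabel :=
  if y.lineClicks Z && !y.lineClicks X then some Z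
  else if y.lineClicks X && !y.lineClicks Z then some X
  else none

end BobRecord

/-- Beam splitter amplitude: `a + b` photons of a mode enter a beam splitter of transmittance `t`,
`a` of them are transmitted and `b` are reflected. -/
def bsAmp (t : ℝ) (a b : ℕ) : ℝ := √(((a + b).choose a : ℝ) * t ^ a * (1 - t) ^ b)

/-- Amplitude for the photons of one mode to end up as `p`: the beam splitter of transmittance
`eta` that stands for the detection efficiency, then Bob's beam splitter. -/
def portAmp (P : Params) (p : Ports) : ℝ :=
  bsAmp P.eta (p.onX + p.onZ) p.lost * bsAmp P.q p.onX p.onZ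

/-- Probability of the dark counts and of the random bit. -/
def noiseProb (P : Params) (y : BobRecord) : ℝ :=
  (∏ ℓ : BasisLabel, ∏ b : Bool, if y.dark ℓ b then P.d else 1 - P.d) * (1 / 2)

/-! ### The law of the virtual protocol -/

/-- A run of the virtual protocol: Alice's and Bob's records in the `N` rounds. -/
abbrev Run (N : ℕ) := (Fin N → AliceRecord) × (Fin N → BobRecord)

section law

variable {N : ℕ} {K : Type*} [NormedAddCommGroup K] [InnerProductSpace ℂ K]

/-- The (unnormalized) state of Eve's system after Alice's outcomes `r.1` and the detection of the
photon numbers of `r.2` in the output modes of Bob's receiver. -/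
def finalState (P : Params) (V : Attack N K) (r : Run N) : K :=
  ((∏ i, (portAmp P (r.2 i).diag * portAmp P (r.2 i).anti) : ℝ) : ℂ) •
    (V (emitted P r.1) : (Fin N → ℕ × ℕ) → K) (fun i => (r.2 i).incoming)

/-- Born's rule, with the independent dark counts and random bits. -/
def runProb (P : Params) (V : Attack N K) (r : Run N) : ℝ :=
  ‖finalState P V r‖ ^ 2 * ∏ i, noiseProb P (r.2 i)

end law


/-! ### Normalization of the law -/

section normalization

theorem tsum_pi_prod {β : Type*} : ∀ {N : ℕ} (h : Fin N → β → ℝ≥0∞),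
    ∑' y : Fin N → β, ∏ i, h i (y i) = ∏ i, ∑' b, h i b := by
  intro N
  induction N with
  | zero => intro h; simp
  | succ N ih =>
    intro h
    rw [Fin.prod_univ_succ, ← ih, ← (Fin.consEquiv fun _ => β).tsum_eq]
    simp only [Fin.consEquiv, Equiv.coe_fn_mk, Fin.prod_univ_succ, Fin.cons_zero, Fin.cons_succ]
    rw [ENNReal.tsum_prod (f := fun b (y : Fin N → β) => h 0 b * ∏ i, h i.succ (y i))]
    simp_rw [ENNReal.tsum_mul_left, ENNReal.tsum_mul_right]

theorem sum_numberAmp_sq (v : ℝ × ℝ) (hv : v.1 ^ 2 + v.2 ^ 2 = 1) (n : ℕ) :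
    ∑ k ∈ Finset.HasAntidiagonal.antidiagonal n, numberAmp v n k ^ 2 = 1 := by
  rw [← one_pow n, ← hv, (Commute.all _ _).add_pow']
  refine Finset.sum_congr rfl fun k hk => ?_
  rw [Finset.HasAntidiagonal.mem_antidiagonal] at hk
  rw [numberAmp, if_pos hk, mul_pow, mul_pow, Real.sq_sqrt (Nat.cast_nonneg _), nsmul_eq_mul]
  ring

theorem polarization_unit (α : BasisLabel) (a : Bool) :
    (polarization α a).1 ^ 2 + (polarization α a).2 ^ 2 = 1 := by
  cases α <;> cases a <;> norm_num [polarization]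

theorem Params.pPhoton_nonneg (P : Params) (ω : Intensity) (n : ℕ) : 0 ≤ P.pPhoton ω n := by
  have h : 0 ≤ P.mu ω := by
    have h1 := P.mu_D_pos
    have h2 := P.mu_D_lt
    cases ω
    · linarith
    · exact h1.le
    · exact P.mu_V.ge
  unfold Params.pPhoton
  positivity

theorem sum_emitAmp_sq (P : Params) (α : BasisLabel) (ω : Intensity) (n : ℕ) :
    ∑ s : Bool, ∑ k ∈ Finset.HasAntidiagonal.antidiagonal n, emitAmp P ⟨α, ω, n, s⟩ k ^ 2 =
      P.pInten ω * P.pPhoton ω n * P.pBasis α := by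
  have hc : 0 ≤ P.pInten ω * P.pPhoton ω n * P.pBasis α / 2 := by
    have := P.pPhoton_nonneg ω n
    have := P.pInten_pos ω
    have := P.pBasis_pos α
    positivity
  have key : ∀ k, ∑ s : Bool, emitAmp P ⟨α, ω, n, s⟩ k ^ 2 =
      (P.pInten ω * P.pPhoton ω n * P.pBasis α / 2) *
        (numberAmp (polarization α false) n k ^ 2 + numberAmp (polarization α true) n k ^ 2) := by
    intro k
    have h2 : (√(2 : ℝ)) ^ 2 = 2 := Real.sq_sqrt (by norm_num)
    have h3 := Real.sq_sqrt hc
    simp only [emitAmp, Fintype.sum_bool]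
    generalize √(P.pInten ω * P.pPhoton ω n * P.pBasis α / 2) = c at *
    rw [← h3]
    cases α
    · simp only [bitOverlap]
      have h4 : (1 / √(2 : ℝ)) ^ 2 = 1 / 2 := by rw [div_pow, h2]; norm_num
      generalize 1 / √(2 : ℝ) = w at *
      simp only [Bool.and_self, Bool.and_true, Bool.and_false, if_true,
        Bool.false_eq_true, if_false]
      generalize numberAmp (polarization BasisLabel.Z false) n k = A
      generalize numberAmp (polarization BasisLabel.Z true) n k = B
      linear_combination (2 * c ^ 2 * (A ^ 2 + B ^ 2)) * h4
    · simp only [bitOverlap]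
      simp
      ring
  rw [Finset.sum_comm]
  simp_rw [key]
  rw [← Finset.mul_sum, Finset.sum_add_distrib, sum_numberAmp_sq _ (polarization_unit _ _),
    sum_numberAmp_sq _ (polarization_unit _ _)]
  ring

/-- Probability of a record of Alice. -/
def aliceProb (P : Params) (r : AliceRecord) : ℝ :=
  ∑ k ∈ Finset.HasAntidiagonal.antidiagonal r.photons, emitAmp P r k ^ 2

theorem aliceProb_nonneg (P : Params) (r : AliceRecord) : 0 ≤ aliceProb P r :=
  Finset.sum_nonneg fun _ _ => sq_nonneg _

theorem tsum_pPhoton (P : Params) (ω : Intensity) :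
    ∑' n, ENNReal.ofReal (P.pPhoton ω n) = 1 := by
  have h : 0 ≤ P.mu ω := by
    have h1 := P.mu_D_pos
    have h2 := P.mu_D_lt
    cases ω
    · linarith
    · exact h1.le
    · exact P.mu_V.ge
  have hs := ProbabilityTheory.hasSum_one_poissonMeasure ⟨P.mu ω, h⟩
  rw [← ENNReal.ofReal_tsum_of_nonneg (P.pPhoton_nonneg ω) hs.summable]
  have ht : ∑' n, P.pPhoton ω n = 1 := hs.tsum_eq
  rw [ht, ENNReal.ofReal_one]

/-- A record of Alice as a tuple. -/
def aliceEquiv : BasisLabel × Intensity × ℕ × Bool ≃ AliceRecord where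
  toFun t := ⟨t.1, t.2.1, t.2.2.1, t.2.2.2⟩
  invFun r := (r.basis, r.inten, r.photons, r.bit)
  left_inv _ := rfl
  right_inv _ := rfl

theorem tsum_aliceProb (P : Params) :
    ∑' r : AliceRecord, ENNReal.ofReal (aliceProb P r) = 1 := by
  rw [← aliceEquiv.tsum_eq]
  change ∑' t : BasisLabel × Intensity × ℕ × Bool,
    ENNReal.ofReal (aliceProb P ⟨t.1, t.2.1, t.2.2.1, t.2.2.2⟩) = 1
  rw [ENNReal.tsum_prod (f := fun α (t : Intensity × ℕ × Bool) =>
    ENNReal.ofReal (aliceProb P ⟨α, t.1, t.2.1, t.2.2⟩))]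
  have h1 : ∀ α : BasisLabel, ∑' t : Intensity × ℕ × Bool,
      ENNReal.ofReal (aliceProb P ⟨α, t.1, t.2.1, t.2.2⟩) = ENNReal.ofReal (P.pBasis α) := by
    intro α
    rw [ENNReal.tsum_prod (f := fun ω (t : ℕ × Bool) =>
      ENNReal.ofReal (aliceProb P ⟨α, ω, t.1, t.2⟩))]
    have h2 : ∀ ω : Intensity, ∑' t : ℕ × Bool, ENNReal.ofReal (aliceProb P ⟨α, ω, t.1, t.2⟩) =
        ENNReal.ofReal (P.pInten ω) * ENNReal.ofReal (P.pBasis α) := by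
      intro ω
      rw [ENNReal.tsum_prod (f := fun n (s : Bool) =>
        ENNReal.ofReal (aliceProb P ⟨α, ω, n, s⟩))]
      have h3 : ∀ n, ∑' s : Bool, ENNReal.ofReal (aliceProb P ⟨α, ω, n, s⟩) =
          ENNReal.ofReal (P.pInten ω) * ENNReal.ofReal (P.pBasis α) *
            ENNReal.ofReal (P.pPhoton ω n) := by
        intro n
        rw [tsum_fintype, ← ENNReal.ofReal_sum_of_nonneg
          (fun s _ => aliceProb_nonneg P _),
          ← ENNReal.ofReal_mul (P.pInten_pos ω).le,
          ← ENNReal.ofReal_mul (mul_nonneg (P.pInten_pos ω).le (P.pBasis_pos α).le)]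
        unfold aliceProb
        simp only [sum_emitAmp_sq]
        congr 1
        ring
      simp_rw [h3]
      rw [ENNReal.tsum_mul_left, tsum_pPhoton, mul_one]
    simp_rw [h2]
    rw [ENNReal.tsum_mul_right, tsum_fintype, ← ENNReal.ofReal_sum_of_nonneg
      (fun ω _ => (P.pInten_pos ω).le)]
    have : ∑ ω : Intensity, P.pInten ω = 1 := by
      rw [← P.pInten_sum]
      change ∑ ω ∈ ({Intensity.S, Intensity.D, Intensity.V} : Finset Intensity), P.pInten ω = _
      simp [add_assoc]
    rw [this]
    simp
  simp_rw [h1]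
  rw [tsum_fintype, ← ENNReal.ofReal_sum_of_nonneg (fun α _ => (P.pBasis_pos α).le)]
  have : ∑ α : BasisLabel, P.pBasis α = 1 := by
    rw [← P.pBasis_sum]
    change ∑ α ∈ ({BasisLabel.Z, BasisLabel.X} : Finset BasisLabel), P.pBasis α = _
    simp
  rw [this]
  simp

theorem norm_emitted_sq (P : Params) {N : ℕ} (x : Fin N → AliceRecord) :
    ‖emitted P x‖ ^ 2 = ∏ i, aliceProb P (x i) := by
  have h := lp.norm_sum_single (p := 2) (E := fun _ : Fin N → ℕ × ℕ => ℂ) (by norm_num)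
    (fun k => (((∏ i, emitAmp P (x i) (k i) : ℝ)) : ℂ))
    (Fintype.piFinset (fun i => Finset.HasAntidiagonal.antidiagonal (x i).photons))
  simp only [ENNReal.toReal_ofNat, Real.rpow_ofNat, Complex.norm_real, Real.norm_eq_abs, sq_abs]
    at h
  unfold emitted aliceProb
  rw [h, Finset.prod_univ_sum]
  simp_rw [Finset.prod_pow]

theorem tsum_bsAmp (t : ℝ) (h0 : 0 ≤ t) (h1 : t ≤ 1) (n : ℕ) :
    ∑' p : ℕ × ℕ, (if p.1 + p.2 = n then ENNReal.ofReal (bsAmp t p.1 p.2 ^ 2) else 0) = 1 := by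
  rw [tsum_eq_sum (s := Finset.HasAntidiagonal.antidiagonal n)]
  · have : ∀ p ∈ Finset.HasAntidiagonal.antidiagonal n,
        (if p.1 + p.2 = n then ENNReal.ofReal (bsAmp t p.1 p.2 ^ 2) else 0) =
          ENNReal.ofReal (n.choose p.1 • (t ^ p.1 * (1 - t) ^ p.2)) := by
      intro p hp
      rw [Finset.HasAntidiagonal.mem_antidiagonal] at hp
      have h2 : 0 ≤ 1 - t := by linarith
      rw [if_pos hp, bsAmp, Real.sq_sqrt (by positivity), hp, nsmul_eq_mul, mul_assoc]
    rw [Finset.sum_congr rfl this, ← ENNReal.ofReal_sum_of_nonneg, ← (Commute.all _ _).add_pow']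
    · simp
    · intro p _
      have h2 : 0 ≤ 1 - t := by linarith
      positivity
  · intro p hp
    rw [Finset.HasAntidiagonal.mem_antidiagonal] at hp
    rw [if_neg hp]

/-- The photon numbers of a mode as a tuple. -/
def portsEquiv : ℕ × ℕ × ℕ ≃ Ports where
  toFun t := ⟨t.1, t.2.2, t.2.1⟩
  invFun p := (p.lost, p.onX, p.onZ)
  left_inv _ := rfl
  right_inv _ := rfl

theorem tsum_portAmp (P : Params) (n : ℕ) :
    ∑' p : Ports, (if p.total = n then ENNReal.ofReal (portAmp P p ^ 2) else 0) = 1 := by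
  have hq := P.q_pos
  have hq' := P.q_lt
  rw [← portsEquiv.tsum_eq]
  change ∑' t : ℕ × ℕ × ℕ, (if (⟨t.1, t.2.2, t.2.1⟩ : Ports).total = n then
    ENNReal.ofReal (portAmp P ⟨t.1, t.2.2, t.2.1⟩ ^ 2) else 0) = 1
  rw [ENNReal.tsum_prod (f := fun l (t : ℕ × ℕ) => if (⟨l, t.2, t.1⟩ : Ports).total = n then
    ENNReal.ofReal (portAmp P ⟨l, t.2, t.1⟩ ^ 2) else 0)]
  have h0 := tsum_bsAmp P.eta P.eta_pos.le P.eta_le n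
  rw [ENNReal.tsum_prod (f := fun j l => if j + l = n then
    ENNReal.ofReal (bsAmp P.eta j l ^ 2) else 0), ENNReal.tsum_comm] at h0
  refine Eq.trans (tsum_congr fun l => ?_) h0
  have h : ∀ j, (if j + l = n then ENNReal.ofReal (bsAmp P.eta j l ^ 2) else 0) =
      ∑' p : ℕ × ℕ, (if j + l = n then ENNReal.ofReal (bsAmp P.eta j l ^ 2) else 0) *
        (if p.1 + p.2 = j then ENNReal.ofReal (bsAmp P.q p.1 p.2 ^ 2) else 0) := by
    intro j
    rw [ENNReal.tsum_mul_left, tsum_bsAmp P.q hq.le (by linarith), mul_one]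
  rw [tsum_congr h, ENNReal.tsum_comm]
  refine tsum_congr fun t => ?_
  rw [tsum_eq_single (t.1 + t.2)]
  · rw [if_pos rfl, portAmp, mul_pow, ENNReal.ofReal_mul (sq_nonneg _), Ports.total]
    by_cases hn : t.1 + t.2 + l = n
    · rw [if_pos hn, if_pos (by dsimp only; omega)]
    · rw [if_neg hn, if_neg (by dsimp only; omega), zero_mul]
  · intro j hj
    rw [if_neg (Ne.symm hj), mul_zero]

/-- A record of Bob as a tuple. -/
def bobEquiv : Ports × Ports × (BasisLabel → Bool → Bool) × Bool ≃ BobRecord where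
  toFun t := ⟨t.1, t.2.1, t.2.2.1, t.2.2.2⟩
  invFun y := (y.diag, y.anti, y.dark, y.coin)
  left_inv _ := rfl
  right_inv _ := rfl

theorem noiseProb_nonneg (P : Params) (y : BobRecord) : 0 ≤ noiseProb P y := by
  unfold noiseProb
  refine mul_nonneg (Finset.prod_nonneg fun ℓ _ => Finset.prod_nonneg fun b _ => ?_) (by norm_num)
  have h1 := P.d_nonneg
  have h2 := P.d_lt
  split_ifs <;> linarith

theorem sum_noiseProb (P : Params) (p p' : Ports) :
    ∑ t : (BasisLabel → Bool → Bool) × Bool, noiseProb P ⟨p, p', t.1, t.2⟩ = 1 := by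
  have h2 : ∑ e : BasisLabel → Bool → Bool,
      ∏ ℓ : BasisLabel, ∏ b : Bool, (if e ℓ b then P.d else 1 - P.d) = 1 := by
    have h := Finset.prod_univ_sum (fun _ : BasisLabel => (Finset.univ : Finset (Bool → Bool)))
      (fun _ g => ∏ b : Bool, (if g b then P.d else 1 - P.d))
    rw [Fintype.piFinset_univ] at h
    rw [← h]
    refine Finset.prod_eq_one fun ℓ _ => ?_
    have h' := Finset.prod_univ_sum (fun _ : Bool => (Finset.univ : Finset Bool))
      (fun _ g => (if g then P.d else 1 - P.d))
    rw [Fintype.piFinset_univ] at h'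
    rw [← h']
    simp
  rw [Fintype.sum_prod_type]
  simp only [noiseProb, Fintype.sum_bool]
  simp_rw [← mul_add]
  rw [← Finset.sum_mul, h2]
  norm_num

/-- Probability of a record of Bob given the photon numbers of the received pulse. -/
def bobProb (P : Params) (y : BobRecord) : ℝ :=
  (portAmp P y.diag * portAmp P y.anti) ^ 2 * noiseProb P y

theorem bobProb_nonneg (P : Params) (y : BobRecord) : 0 ≤ bobProb P y :=
  mul_nonneg (sq_nonneg _) (noiseProb_nonneg P y)

theorem tsum_bobProb (P : Params) (k : ℕ × ℕ) :
    ∑' y : BobRecord, (if y.incoming = k then ENNReal.ofReal (bobProb P y) else 0) = 1 := by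
  rw [← bobEquiv.tsum_eq]
  have h : ∀ t : Ports × Ports × (BasisLabel → Bool → Bool) × Bool,
      (if (bobEquiv t).incoming = k then ENNReal.ofReal (bobProb P (bobEquiv t)) else 0) =
        (if t.1.total = k.1 then ENNReal.ofReal (portAmp P t.1 ^ 2) else 0) *
          ((if t.2.1.total = k.2 then ENNReal.ofReal (portAmp P t.2.1 ^ 2) else 0) *
            ENNReal.ofReal (noiseProb P ⟨t.1, t.2.1, t.2.2.1, t.2.2.2⟩)) := by
    rintro ⟨p, p', e, c⟩
    obtain ⟨k1, k2⟩ := k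
    simp only [bobEquiv, Equiv.coe_fn_mk, BobRecord.incoming, bobProb, Prod.mk.injEq]
    by_cases h1 : p.total = k1 <;> by_cases h2 : p'.total = k2
    · simp only [h1, h2, and_self, if_true]
      rw [mul_pow, ENNReal.ofReal_mul (by positivity), ENNReal.ofReal_mul (by positivity),
        mul_assoc]
    all_goals simp [h1, h2]
  simp_rw [h]
  rw [ENNReal.tsum_prod (f := fun p (t : Ports × (BasisLabel → Bool → Bool) × Bool) =>
    (if p.total = k.1 then ENNReal.ofReal (portAmp P p ^ 2) else 0) *
      ((if t.1.total = k.2 then ENNReal.ofReal (portAmp P t.1 ^ 2) else 0) *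
        ENNReal.ofReal (noiseProb P ⟨p, t.1, t.2.1, t.2.2⟩)))]
  rw [← tsum_portAmp P k.1]
  refine tsum_congr fun p => ?_
  rw [ENNReal.tsum_mul_left]
  have h3 : ∑' t : Ports × (BasisLabel → Bool → Bool) × Bool,
      ((if t.1.total = k.2 then ENNReal.ofReal (portAmp P t.1 ^ 2) else 0) *
        ENNReal.ofReal (noiseProb P ⟨p, t.1, t.2.1, t.2.2⟩)) = 1 := by
    rw [ENNReal.tsum_prod (f := fun p' (t : (BasisLabel → Bool → Bool) × Bool) =>
      (if p'.total = k.2 then ENNReal.ofReal (portAmp P p' ^ 2) else 0) *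
        ENNReal.ofReal (noiseProb P ⟨p, p', t.1, t.2⟩))]
    rw [← tsum_portAmp P k.2]
    refine tsum_congr fun p' => ?_
    rw [ENNReal.tsum_mul_left, tsum_fintype,
      ← ENNReal.ofReal_sum_of_nonneg (fun _ _ => noiseProb_nonneg P _), sum_noiseProb,
      ENNReal.ofReal_one, mul_one]
  rw [h3, mul_one]

theorem tsum_runProb (P : Params) {N : ℕ} {K : Type*} [NormedAddCommGroup K]
    [InnerProductSpace ℂ K] (V : Attack N K) :
    ∑' r : Run N, ENNReal.ofReal (runProb P V r) = 1 := by
  have hrun : ∀ (x : Fin N → AliceRecord) (y : Fin N → BobRecord),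
      ENNReal.ofReal (runProb P V (x, y)) = ∑' k : Fin N → ℕ × ℕ,
        ENNReal.ofReal (‖(V (emitted P x) : (Fin N → ℕ × ℕ) → K) k‖ ^ 2) *
          ∏ i, (if (y i).incoming = k i then ENNReal.ofReal (bobProb P (y i)) else 0) := by
    intro x y
    rw [tsum_eq_single (fun i => (y i).incoming)]
    · simp only [if_true, runProb, finalState]
      rw [← ENNReal.ofReal_prod_of_nonneg (fun i _ => bobProb_nonneg P _),
        ← ENNReal.ofReal_mul (sq_nonneg _), norm_smul, mul_pow, Complex.norm_real,
        Real.norm_eq_abs, sq_abs]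
      simp only [bobProb, Finset.prod_mul_distrib, Finset.prod_pow]
      congr 1
      ring
    · intro k hk
      have : ∃ i, (y i).incoming ≠ k i := by
        by_contra hcon
        push Not at hcon
        exact hk (funext fun i => (hcon i).symm)
      obtain ⟨i, hi⟩ := this
      rw [Finset.prod_eq_zero (Finset.mem_univ i) (if_neg hi), mul_zero]
  rw [ENNReal.tsum_prod (f := fun x y => ENNReal.ofReal (runProb P V (x, y)))]
  have hx : ∀ x : Fin N → AliceRecord, ∑' y : Fin N → BobRecord,
      ENNReal.ofReal (runProb P V (x, y)) = ∏ i, ENNReal.ofReal (aliceProb P (x i)) := by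
    intro x
    simp_rw [hrun]
    rw [ENNReal.tsum_comm]
    simp_rw [ENNReal.tsum_mul_left]
    have h1 : ∀ k : Fin N → ℕ × ℕ, ∑' y : Fin N → BobRecord,
        ∏ i, (if (y i).incoming = k i then ENNReal.ofReal (bobProb P (y i)) else 0) = 1 := by
      intro k
      rw [tsum_pi_prod (fun i y => if y.incoming = k i then ENNReal.ofReal (bobProb P y) else 0)]
      exact Finset.prod_eq_one fun i _ => tsum_bobProb P (k i)
    simp_rw [h1, mul_one]
    have h2 := lp.hasSum_norm (p := 2) (by norm_num) (V (emitted P x))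
    simp only [ENNReal.toReal_ofNat, Real.rpow_ofNat] at h2
    rw [← ENNReal.ofReal_tsum_of_nonneg (fun k => sq_nonneg _) h2.summable, h2.tsum_eq,
      V.norm_map, norm_emitted_sq, ENNReal.ofReal_prod_of_nonneg]
    exact fun i _ => aliceProb_nonneg P _
  simp_rw [hx]
  rw [tsum_pi_prod (fun _ r => ENNReal.ofReal (aliceProb P r))]
  exact Finset.prod_eq_one fun i _ => tsum_aliceProb P

end normalization

/-- The law of the virtual protocol under the attack `V`. -/
def law (P : Params) {N : ℕ} {K : Type*} [NormedAddCommGroup K] [InnerProductSpace ℂ K]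
    (V : Attack N K) : PMF (Run N) :=
  ⟨fun r => ENNReal.ofReal (runProb P V r), by
    rw [← tsum_runProb P V]; exact ENNReal.summable.hasSum⟩

/-! ### Counts -/

/-- Values of `e_X`: the bits of Alice and Bob are identical (`0`) or different (`1`), there is
no click, or there is a cross-click. -/
inductive XResult
  | same
  | differ
  | noClick
  | cross
  deriving DecidableEq

/-- The value of `e_X` in a round. -/
def eX (x : AliceRecord) (y : BobRecord) : XResult :=
  if y.lineClicks Z && y.lineClicks X then .cross
  else if y.lineClicks Z then (if x.bit = y.bitOn Z then .same else .differ)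
  else if y.lineClicks X then (if x.bit = y.bitOn X then .same else .differ)
  else .noClick

/-- Number of phase errors in the rounds in which Alice emits `n` photons. -/
def numPh {N : ℕ} (n : ℕ) (r : Run N) : ℕ :=
  (Finset.univ.filter fun i => (r.1 i).basis = Z ∧ (r.1 i).photons = n ∧
    (r.2 i).beta = some Z ∧ eX (r.1 i) (r.2 i) = .differ).card

/-- Number of bit errors in the `X` basis with intensity label `ω`. -/
def numErrorX {N : ℕ} (r : Run N) (ω : Intensity) : ℕ :=
  (Finset.univ.filter fun i => (r.1 i).basis = X ∧ (r.1 i).inten = ω ∧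
    (r.2 i).beta = some X ∧ eX (r.1 i) (r.2 i) = .differ).card

/-- Number of cross-clicks with intensity label `ω`. -/
def numCross {N : ℕ} (r : Run N) (ω : Intensity) : ℕ :=
  (Finset.univ.filter fun i => (r.1 i).inten = ω ∧ eX (r.1 i) (r.2 i) = .cross).card

/-! ### The deviation terms of Kato's inequality -/

def aU (N : ℕ) (C ε : ℝ) : ℝ :=
  (216 * √(N : ℝ) * C * (N - C) * Real.log ε - 48 * (N : ℝ) ^ (3 / 2 : ℝ) * Real.log ε ^ 2
      + 27 * √2 * (N - 2 * C) *
        √(-(N : ℝ) ^ 2 * Real.log ε * (9 * C * (N - C) - 2 * N * Real.log ε))) /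
    (4 * (9 * N - 8 * Real.log ε) * (9 * C * (N - C) - 2 * N * Real.log ε))

def bU (N : ℕ) (C ε : ℝ) : ℝ :=
  √(aU N C ε ^ 2 + 1 / 2 * (1 + 4 * aU N C ε / √(9 * N : ℝ)) ^ 2 * Real.log (1 / ε))

def aL (N : ℕ) (C ε : ℝ) : ℝ :=
  (-216 * √(N : ℝ) * C * (N - C) * Real.log ε + 48 * (N : ℝ) ^ (3 / 2 : ℝ) * Real.log ε ^ 2
      + 27 * √2 * (N - 2 * C) *
        √(-(N : ℝ) ^ 2 * Real.log ε * (9 * C * (N - C) - 2 * N * Real.log ε))) /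
    (4 * (9 * N - 8 * Real.log ε) * (9 * C * (N - C) - 2 * N * Real.log ε))

def bL (N : ℕ) (C ε : ℝ) : ℝ :=
  √(aL N C ε ^ 2 + 1 / 2 * (1 - 4 * aL N C ε / √(9 * N : ℝ)) ^ 2 * Real.log (1 / ε))

/-- Deviation term for upper-bounding a sum of probabilities; `M` is the observed number and `C`
its estimate. -/
def deltaU (M C : ℝ) (N : ℕ) (ε : ℝ) : ℝ :=
  (bU N C ε * N + aU N C ε * (2 * M - N)) / √(N : ℝ)

/-- Deviation term for lower-bounding a sum of probabilities; `M` is the observed number and `C`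
its estimate. -/
def deltaL (M C : ℝ) (N : ℕ) (ε : ℝ) : ℝ :=
  (bL N C ε * N + aL N C ε * (2 * M - N)) / √(N : ℝ)

/-! ### The bound -/

/-- The decoy-state combination
`e^{μ_D} (M_D + Δ_U(M_D)) / p_D - (M_V - Δ_L(M_V)) / p_V` of the counts `M` with estimates `C`. -/
def decoyTerm (P : Params) (N : ℕ) (ε : ℝ) (C : Intensity → ℝ) (M : Intensity → ℕ) : ℝ :=
  Real.exp (P.mu D) * (M D + deltaU (M D) (C D) N ε) / P.pInten D -
    (M V - deltaL (M V) (C V) N ε) / P.pInten V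

/-- The upper bound on the number of single-photon phase errors, as a function of the observed
counts `err` of errors in the `X` basis and `cross` of cross-clicks; `estPh`, `estErr` and
`estCross` are the estimates fixed in advance. -/
def nPhUpper (P : Params) (N : ℕ) (ε estPh : ℝ) (estErr estCross : Intensity → ℝ)
    (err cross : Intensity → ℕ) : ℝ :=
  if aL N estPh ε < √(N : ℝ) / 2 then
    (1 - 2 * aL N estPh ε / √(N : ℝ))⁻¹ *
      (P.pPhotonAvg 1 / P.mu D *
          (P.c₁ * decoyTerm P N ε estErr err + P.c₂ * decoyTerm P N ε estCross cross) +
        (bL N estPh ε - aL N estPh ε) * √(N : ℝ))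
  else N

/-- The bound for Bob choosing his basis actively (with probabilities `1 - q` and `q`): the same
closed form built from the error counts only. -/
def nPhUpperActive (P : Params) (N : ℕ) (ε estPh : ℝ) (estErr : Intensity → ℝ)
    (err : Intensity → ℕ) : ℝ :=
  if aL N estPh ε < √(N : ℝ) / 2 then
    (1 - 2 * aL N estPh ε / √(N : ℝ))⁻¹ *
      (P.pPhotonAvg 1 / P.mu D * (P.c₁ * decoyTerm P N ε estErr err) +
        (bL N estPh ε - aL N estPh ε) * √(N : ℝ))
  else N

end PassiveBB84

end

noncomputable section

namespace PassiveBB84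

/-! ### Kato's inequality: the exponent -/

/-! In the virtual protocol Bob measures diagonal polarization on both lines, so an error on the `Z`
line and an error on the `X` line differ only in where the beam splitter sends the photons. Fix one
round, the records of all the others, and the number m of photons that survive the losses. A
detection on one line only forces all m photons onto that line, which has probability (1-q)^m for
`Z` and q^m for `X`; after that the error probability B is the same on both lines, and B ≤ (1-d)².
For m ≤ 1 the factor (1-q)/q turns `X` errors into a bound on `Z` errors. For m ≥ 2 there is a
deficit of at most (1-q)(1-2q)B, but then a cross-click has probability at least
1-(q²+(1-q)²)(1-d)², and `c₂` is p_Z times the resulting ratio (`receiverMean_differOn_le`). The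
receiver counts photons in the diagonal and anti-diagonal modes, so the inequality can be averaged
over the received photon numbers, whatever their weights (`tsum_differOn_le`).

On Alice's side, single-photon pulses are the same in both bases (`emitShape_one`), so the attack
responds to them independently of the basis. Given the photon number, the intensity label enters
only as a scalar weight (`runProb_runSplit`), so yields do not depend on the label, and the decoy
and vacuum labels together bound the single-photon yields (`decoy_le`). The result is a linear
inequality between the probability of a single-photon phase error and those of four observable
events (`roundWeight_le`). Summed over all runs in an event of the past, it passes to conditional
probabilities given the past (`condProb_phaseErrorEvent_le`), hence to their sums over the rounds.

Kato's inequality (`kato_upper`, `kato_lower`) then compares sums of conditional probabilities with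
counts. It is used five times, once for the phase errors and once for each observable event, each
time failing with probability at most ε. Since the deviation is affine in the count, the resulting
inequality can be solved for the number of phase errors (`numPh_le_nPhUpper`). -/

/-- Relative entropy of two Bernoulli laws. -/
def bernoulliEntropy (x p : ℝ) : ℝ :=
  x * (Real.log x - Real.log p) + (1 - x) * (Real.log (1 - x) - Real.log (1 - p))

/-- The two sides are the derivatives in p of Massart's expression (p-x)²/(2y(1-y)), y = (2p+x)/3,
and of the relative entropy. With δ = p-x, v = y(1-y) and w = δ(1-2y)/3 one has p(1-p) = v + w -
δ²/9, so (v-w)p(1-p) ≤ v² - w² if v ≥ w, while the left side is nonpositive otherwise. -/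
theorem massart_deriv_le {x p : ℝ} (hx : 0 < x) (hxp : x < p) (hp : p < 1) :
    (p - x) / (2 * ((2 * p + x) / 3) * (1 - (2 * p + x) / 3)) * 2 -
      (p - x) ^ 2 * (2 * (2 / 3) * (1 - (2 * p + x) / 3) - 2 * ((2 * p + x) / 3) * (2 / 3)) /
        (2 * ((2 * p + x) / 3) * (1 - (2 * p + x) / 3)) ^ 2 ≤ (p - x) / (p * (1 - p)) := by
  obtain ⟨δ, hδ⟩ : ∃ δ, δ = p - x := ⟨_, rfl⟩
  obtain ⟨y, hy⟩ : ∃ y, y = (2 * p + x) / 3 := ⟨_, rfl⟩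
  have hp' : p = y + δ / 3 := by rw [hδ, hy]; ring
  rw [← hδ, ← hy]
  have hδ0 : 0 < δ := by linarith
  have hy0 : 0 < y := by linarith
  have hy1 : 0 < 1 - y := by linarith
  have hv : 0 < y * (1 - y) := mul_pos hy0 hy1
  have hpp : 0 < p * (1 - p) := mul_pos (by linarith) (by linarith)
  have key : (y * (1 - y) - δ / 3 * (1 - 2 * y)) * (p * (1 - p)) ≤ (y * (1 - y)) ^ 2 := by
    rcases le_total (y * (1 - y) - δ / 3 * (1 - 2 * y)) 0 with h | h
    · nlinarith [mul_nonneg (neg_nonneg.2 h) hpp.le, sq_nonneg (y * (1 - y))]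
    · have : p * (1 - p) = y * (1 - y) + δ / 3 * (1 - 2 * y) - δ ^ 2 / 9 := by rw [hp']; ring
      rw [this]
      nlinarith [mul_nonneg h (sq_nonneg δ), sq_nonneg (δ / 3 * (1 - 2 * y))]
  have e : δ / (2 * y * (1 - y)) * 2 - δ ^ 2 * (2 * (2 / 3) * (1 - y) - 2 * y * (2 / 3)) /
      (2 * y * (1 - y)) ^ 2 = δ * ((y * (1 - y) - δ / 3 * (1 - 2 * y)) / (y * (1 - y)) ^ 2) := by
    field_simp
    ring
  rw [e, div_eq_mul_one_div δ (p * (1 - p))]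
  refine mul_le_mul_of_nonneg_left ?_ hδ0.le
  rw [div_le_div_iff₀ (by positivity) hpp]
  linarith

/-- Massart's lower bound on the relative entropy of two Bernoulli laws. -/
theorem massart_le_bernoulliEntropy {x p : ℝ} (hx : 0 < x) (hxp : x ≤ p) (hp : p < 1) :
    (p - x) ^ 2 / (2 * ((2 * p + x) / 3) * (1 - (2 * p + x) / 3)) ≤ bernoulliEntropy x p := by
  let F : ℝ → ℝ := fun p => bernoulliEntropy x p -
    (p - x) ^ 2 / (2 * ((2 * p + x) / 3) * (1 - (2 * p + x) / 3))
  have hF : ∀ s ∈ Set.Ico x 1, HasDerivAt F ((s - x) / (s * (1 - s)) -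
      ((s - x) / (2 * ((2 * s + x) / 3) * (1 - (2 * s + x) / 3)) * 2 -
      (s - x) ^ 2 * (2 * (2 / 3) * (1 - (2 * s + x) / 3) - 2 * ((2 * s + x) / 3) * (2 / 3)) /
        (2 * ((2 * s + x) / 3) * (1 - (2 * s + x) / 3)) ^ 2)) s := by
    rintro s ⟨hs, hs1⟩
    have hs0 : s ≠ 0 := by linarith
    have hs2 : 1 - s ≠ 0 := by linarith
    have hv : 2 * ((2 * s + x) / 3) * (1 - (2 * s + x) / 3) ≠ 0 :=
      (mul_pos (by linarith) (by linarith)).ne'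
    have h1 : HasDerivAt (fun s => 1 - s) (-1) s := by
      simpa using (hasDerivAt_id s).const_sub 1
    have hent : HasDerivAt (bernoulliEntropy x) ((s - x) / (s * (1 - s))) s := by
      have h := (((Real.hasDerivAt_log hs0).const_sub (Real.log x)).const_mul x).add
        (((h1.log hs2).const_sub (Real.log (1 - x))).const_mul (1 - x))
      refine h.congr_deriv ?_
      field_simp
      ring
    have hy : HasDerivAt (fun s => (2 * s + x) / 3) (2 / 3) s := by
      have := (((hasDerivAt_id s).const_mul 2).add_const x).div_const 3
      simpa using this
    have hn : HasDerivAt (fun s => (s - x) ^ 2) (2 * (s - x)) s := by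
      simpa using ((hasDerivAt_id s).sub_const x).fun_pow 2
    have hd := (hy.const_mul 2).mul (hy.const_sub 1)
    refine (hent.sub (hn.div hd hv)).congr_deriv ?_
    simp only [Pi.mul_apply]
    congr 1
    field_simp
    ring
  -- F vanishes at p = x, so monotonicity to the right of x gives the bound.
  have hmono : MonotoneOn F (Set.Ico x 1) := by
    refine monotoneOn_of_deriv_nonneg (convex_Ico x 1)
      (fun s hs => (hF s hs).continuousAt.continuousWithinAt)
      (fun s hs => (hF s (interior_subset hs)).differentiableAt.differentiableWithinAt) ?_
    intro s hs
    rw [interior_Ico] at hs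
    rw [(hF s ⟨hs.1.le, hs.2⟩).deriv]
    exact sub_nonneg.2 (massart_deriv_le hx hs.1 hs.2)
  have h := hmono ⟨le_rfl, hxp.trans_lt hp⟩ ⟨hxp, hp⟩ hxp
  have h0 : F x = 0 := by simp [F, bernoulliEntropy]
  rw [h0] at h
  exact sub_nonneg.1 h

/-- The relative entropy on the line `p - x = β + α (2 x - 1)`. -/
theorem kato_exponent_le {α β x p : ℝ} (hα : -(1 / 2) < α) (hx : 0 < x) (hxp : x ≤ p) (hp : p < 1)
    (hline : p - x = β + α * (2 * x - 1)) :
    2 * (β ^ 2 - α ^ 2) / (1 + 4 * α / 3) ^ 2 ≤ bernoulliEntropy x p := by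
  refine le_trans ?_ (massart_le_bernoulliEntropy hx hxp hp)
  obtain ⟨y, hy⟩ : ∃ y, y = (2 * p + x) / 3 := ⟨_, rfl⟩
  obtain ⟨k, hk⟩ : ∃ k, k = 1 + 4 * α / 3 := ⟨_, rfl⟩
  rw [← hy, ← hk]
  have hk0 : 0 < k := by linarith
  have hv : 0 < 2 * y * (1 - y) := mul_pos (by linarith) (by linarith)
  -- Since y = x + 2(p-x)/3, replacing x by y on the line multiplies p-x by 1+4α/3; this is the
  -- origin of that factor.
  have hδ : (p - x) * k = β + α * (2 * y - 1) := by
    have h3 : p = x + (β + α * (2 * x - 1)) := by linarith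
    rw [hk, hy, h3]; ring
  have hδ2 : (p - x) ^ 2 * k ^ 2 = (β + α * (2 * y - 1)) ^ 2 := by rw [← hδ]; ring
  rw [div_le_div_iff₀ (by positivity) hv, hδ2]
  -- With w = 2y-1 and 4y(1-y) = 1-w² the claim is (β²-α²)(1-w²) ≤ (β+αw)², and the difference of
  -- the two sides is (α+βw)².
  nlinarith [sq_nonneg (α + β * (2 * y - 1))]

/-- The last equation says that the relative entropy is stationary along the line. A solution exists
by the intermediate value theorem: the function G below tends to +∞ as x tends to 0 and to a
negative limit as p tends to 1. -/
theorem exists_kato_stationary {α β : ℝ} (h1 : |α| < β) (h2 : β < 1 + α) :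
    ∃ p x : ℝ, 0 < x ∧ x < p ∧ p < 1 ∧ p - x = β + α * (2 * x - 1) ∧
      (1 + 2 * α) * (p - x) = p * (1 - p) *
        (Real.log p - Real.log (1 - p) - Real.log x + Real.log (1 - x)) := by
  obtain ⟨h3, h4⟩ := abs_lt.1 h1
  have hc : 0 < 1 + 2 * α := by linarith
  obtain ⟨c, hcdef⟩ : ∃ c, c = 1 + 2 * α := ⟨_, rfl⟩
  rw [← hcdef] at hc
  let x : ℝ → ℝ := fun p => (p - (β - α)) / c
  have hxc : Continuous x := by fun_prop
  have hx0 : ∀ p, β - α < p → 0 < x p := fun p hp => div_pos (by linarith) hc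
  have hx1 : ∀ p, p ≤ 1 → x p < 1 := fun p hp => by
    rw [div_lt_one hc]; linarith
  let G : ℝ → ℝ := fun p => p * (1 - p) *
    (Real.log p - Real.log (1 - p) - Real.log (x p) + Real.log (1 - x p)) - c * (p - x p)
  have hG : ContinuousOn G (Set.Ioo (β - α) 1) := by
    intro p hp
    have a1 : p ≠ 0 := by linarith [hp.1]
    have a2 : 1 - p ≠ 0 := by linarith [hp.2]
    have a3 := (hx0 p hp.1).ne'
    have a4 : 1 - x p ≠ 0 := by linarith [hx1 p hp.2.le]
    refine ContinuousAt.continuousWithinAt ?_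
    fun_prop (disch := assumption)
  have hl : Filter.Tendsto G (nhdsWithin (β - α) (Set.Ioi (β - α))) Filter.atTop := by
    have e : G = fun p => p * (1 - p) * (-Real.log (x p)) + (p * (1 - p) *
      (Real.log p - Real.log (1 - p) + Real.log (1 - x p)) - c * (p - x p)) := by
      funext p; simp only [G]; ring
    rw [e]
    have a1 : β - α ≠ 0 := by linarith
    have a2 : 1 - (β - α) ≠ 0 := by linarith
    have a0 : x (β - α) = 0 := by simp [x]
    have a4 : 1 - x (β - α) ≠ 0 := by simp [a0]
    have hcont : ContinuousAt (fun p => p * (1 - p) *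
      (Real.log p - Real.log (1 - p) + Real.log (1 - x p)) - c * (p - x p)) (β - α) := by
      fun_prop (disch := assumption)
    refine Filter.Tendsto.atTop_add ?_ (hcont.tendsto.mono_left nhdsWithin_le_nhds)
    have hpos : 0 < (β - α) * (1 - (β - α)) := mul_pos (by linarith) (by linarith)
    have hc2 : Filter.Tendsto (fun p : ℝ => p * (1 - p)) (nhdsWithin (β - α) (Set.Ioi (β - α)))
        (nhds ((β - α) * (1 - (β - α)))) :=
      ((by fun_prop : Continuous fun p : ℝ => p * (1 - p)).tendsto _).mono_left nhdsWithin_le_nhds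
    refine Filter.Tendsto.pos_mul_atTop hpos hc2 ?_
    rw [Filter.tendsto_neg_atTop_iff]
    refine Real.tendsto_log_nhdsGT_zero.comp ?_
    refine tendsto_nhdsWithin_iff.2 ⟨?_, ?_⟩
    · rw [← a0]; exact (hxc.tendsto _).mono_left nhdsWithin_le_nhds
    · filter_upwards [self_mem_nhdsWithin] with p hp using hx0 p hp
  have hr : Filter.Tendsto G (nhdsWithin 1 (Set.Iio 1)) (nhds (-(c * (1 - x 1)))) := by
    have e : G = fun p => p * (Real.negMulLog (1 - p)) + (p * (1 - p) *
      (Real.log p - Real.log (x p) + Real.log (1 - x p)) - c * (p - x p)) := by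
      funext p; simp only [G, Real.negMulLog]; ring
    have a1 : (1 : ℝ) ≠ 0 := one_ne_zero
    have a3 := (hx0 1 (by linarith)).ne'
    have a4 : 1 - x 1 ≠ 0 := by linarith [hx1 1 le_rfl]
    have hcont : ContinuousAt G 1 := by
      rw [e]
      have := Real.continuous_negMulLog
      fun_prop (disch := assumption)
    have hv : G 1 = -(c * (1 - x 1)) := by simp [G]
    rw [← hv]
    exact hcont.tendsto.mono_left nhdsWithin_le_nhds
  have hneg : -(c * (1 - x 1)) < 0 := by
    have := mul_pos hc (sub_pos.2 (hx1 1 le_rfl)); linarith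
  have hlt : β - α < 1 := by linarith
  obtain ⟨u, hu, hu'⟩ := ((hl.eventually_gt_atTop 0).and (Ioo_mem_nhdsGT hlt)).exists
  obtain ⟨v, hv, hv'⟩ := ((hr.eventually_lt_const hneg).and (Ioo_mem_nhdsLT hlt)).exists
  obtain ⟨p, hp, hp0⟩ := isPreconnected_Ioo.intermediate_value hv' hu' hG ⟨hv.le, hu.le⟩
  have hline : p - x p = β + α * (2 * x p - 1) := by
    have : c * x p = p - (β - α) := by simp only [x]; field_simp
    rw [hcdef] at this; linarith
  have hxp0 := hx0 p hp.1
  have hxp1 := hx1 p hp.2.le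
  refine ⟨p, x p, hxp0, ?_, hp.2, hline, ?_⟩
  · have : 0 < β + α * (2 * x p - 1) := by nlinarith
    linarith
  · rw [← hcdef]
    simp only [G] at hp0
    linarith

/-- A bound on the moment generating function that is uniform in the success probability. -/
theorem exists_kato_mgf {α β : ℝ} (h1 : |α| < β) (h2 : β < 1 + α) :
    ∃ t : ℝ, 0 < t ∧ ∀ r ∈ Set.Icc (0 : ℝ) 1,
      Real.exp (t * r) * (1 - r * (1 - Real.exp (-(t * (1 + 2 * α))))) ≤
        Real.exp (t * (β - α) - 2 * (β ^ 2 - α ^ 2) / (1 + 4 * α / 3) ^ 2) := by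
  obtain ⟨p, x, hx, hxp, hp, hline, hstat⟩ := exists_kato_stationary h1 h2
  obtain ⟨h3, h4⟩ := abs_lt.1 h1
  have hc : 0 < 1 + 2 * α := by linarith
  have hp0 : 0 < p := hx.trans hxp
  have hp1 : 0 < 1 - p := by linarith
  have hx1 : 0 < 1 - x := by linarith
  -- By stationarity, t(1+2α) is also the logarithm of the odds ratio of p and x. This makes the
  -- function of r to be bounded proportional to e^{tr}(1+t(p-r)), which is maximal at r = p.
  set t := (p - x) / (p * (1 - p)) with ht
  have ht0 : 0 < t := div_pos (by linarith) (mul_pos hp0 hp1)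
  have htc : t * (1 + 2 * α) =
      Real.log p - Real.log (1 - p) - Real.log x + Real.log (1 - x) := by
    rw [ht, div_mul_eq_mul_div, div_eq_iff (mul_pos hp0 hp1).ne']
    linarith
  have hexp : Real.exp (-(t * (1 + 2 * α))) = x * (1 - p) / (p * (1 - x)) := by
    rw [htc, ← Real.exp_log (show 0 < x * (1 - p) / (p * (1 - x)) by positivity),
      Real.log_div (by positivity) (by positivity), Real.log_mul hx.ne' hp1.ne',
      Real.log_mul hp0.ne' hx1.ne']
    congr 1
    ring
  refine ⟨t, ht0, fun r hr => ?_⟩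
  have hA : ∀ r, 1 - r * (1 - Real.exp (-(t * (1 + 2 * α)))) =
      (1 - p) / (1 - x) * (1 + t * (p - r)) := by
    intro r
    rw [hexp, ht]
    field_simp
    ring
  rw [hA]
  have hD := kato_exponent_le (by linarith) hx hxp.le hp hline
  have hx2 : p - (1 + 2 * α) * x = β - α := by linarith
  have hent : t * p + Real.log ((1 - p) / (1 - x)) = t * (β - α) - bernoulliEntropy x p := by
    rw [← hx2, bernoulliEntropy, Real.log_div hp1.ne' hx1.ne']
    have : t * (1 + 2 * α) * x = (Real.log p - Real.log (1 - p) - Real.log x +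
      Real.log (1 - x)) * x := by rw [htc]
    linarith
  -- The bound 1+u ≤ e^u at u = t(p-r) removes r, with equality at r = p.
  calc Real.exp (t * r) * ((1 - p) / (1 - x) * (1 + t * (p - r)))
      ≤ Real.exp (t * r) * ((1 - p) / (1 - x) * Real.exp (t * (p - r))) := by
        have := Real.add_one_le_exp (t * (p - r))
        have h5 : 0 ≤ (1 - p) / (1 - x) := by positivity
        gcongr
        linarith
    _ = Real.exp (t * p + Real.log ((1 - p) / (1 - x))) := by
        rw [Real.exp_add, Real.exp_log (by positivity), mul_left_comm, ← Real.exp_add]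
        rw [mul_comm]
        congr 2
        ring
    _ ≤ _ := by
        rw [hent]
        exact Real.exp_le_exp.2 (by linarith)

/-! ### Kato's inequality -/

section kato

open MeasureTheory

variable {Ω : Type*} {m0 : MeasurableSpace Ω}

/-- Conditional probability of the `i`-th event given the past. -/
def condProb (μ : Measure Ω) (ℱ : Filtration ℕ m0) (A : ℕ → Set Ω) (i : ℕ) : Ω → ℝ :=
  μ[(A i).indicator (fun _ => (1 : ℝ)) | ℱ i]

/-- Number of the first `n` events that occur. -/
def countOf (A : ℕ → Set Ω) (n : ℕ) (ω : Ω) : ℝ :=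
  ∑ i ∈ Finset.range n, (A i).indicator (fun _ => (1 : ℝ)) ω

theorem indicator_one_mem_Icc (s : Set Ω) (ω : Ω) :
    s.indicator (fun _ => (1 : ℝ)) ω ∈ Set.Icc (0 : ℝ) 1 := by
  by_cases h : ω ∈ s <;> simp [h]

theorem countOf_mem_Icc (A : ℕ → Set Ω) (n : ℕ) (ω : Ω) : countOf A n ω ∈ Set.Icc (0 : ℝ) n := by
  refine ⟨Finset.sum_nonneg fun i _ => (indicator_one_mem_Icc _ _).1, ?_⟩
  refine (Finset.sum_le_sum fun i _ => (indicator_one_mem_Icc (A i) ω).2).trans ?_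
  simp

theorem countOf_compl (A : ℕ → Set Ω) (n : ℕ) (ω : Ω) :
    countOf (fun i => (A i)ᶜ) n ω = n - countOf A n ω := by
  rw [eq_sub_iff_add_eq, countOf, countOf, ← Finset.sum_add_distrib]
  rw [Finset.sum_congr rfl (g := fun _ => (1 : ℝ))]
  · simp
  · intro i _
    by_cases h : ω ∈ A i <;> simp [h]

variable (μ : Measure Ω) [IsProbabilityMeasure μ] (ℱ : Filtration ℕ m0) {A : ℕ → Set Ω}

theorem integrable_indicator_one {s : Set Ω} (hs : MeasurableSet s) :
    Integrable (s.indicator (fun _ => (1 : ℝ))) μ :=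
  (integrable_const 1).indicator hs

variable (hA : ∀ i, MeasurableSet[ℱ (i + 1)] (A i))
include hA

theorem condProb_mem_Icc (i : ℕ) : ∀ᵐ ω ∂μ, condProb μ ℱ A i ω ∈ Set.Icc (0 : ℝ) 1 := by
  have hm : MeasurableSet (A i) := ℱ.le _ _ (hA i)
  have h0 : 0 ≤ᵐ[μ] condProb μ ℱ A i :=
    condExp_nonneg (Filter.Eventually.of_forall fun ω => (indicator_one_mem_Icc _ ω).1)
  have h1 : condProb μ ℱ A i ≤ᵐ[μ] μ[(fun _ => (1 : ℝ)) | ℱ i] :=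
    condExp_mono (integrable_indicator_one μ hm) (integrable_const 1)
      (Filter.Eventually.of_forall fun ω => (indicator_one_mem_Icc _ ω).2)
  rw [condExp_const (ℱ.le i)] at h1
  filter_upwards [h0, h1] with ω h0 h1 using ⟨h0, h1⟩

theorem sum_condProb_le (n : ℕ) : ∀ᵐ ω ∂μ, ∑ i ∈ Finset.range n, condProb μ ℱ A i ω ≤ n := by
  filter_upwards [ae_all_iff.2 (condProb_mem_Icc μ ℱ hA)] with ω h
  refine (Finset.sum_le_sum fun i _ => (h i).2).trans ?_
  simp

theorem condProb_compl (i : ℕ) :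
    ∀ᵐ ω ∂μ, condProb μ ℱ (fun i => (A i)ᶜ) i ω = 1 - condProb μ ℱ A i ω := by
  have hm : MeasurableSet (A i) := ℱ.le _ _ (hA i)
  have e : (A i)ᶜ.indicator (fun _ => (1 : ℝ)) =
      (fun _ => (1 : ℝ)) - (A i).indicator (fun _ => (1 : ℝ)) := by
    funext ω
    by_cases h : ω ∈ A i <;> simp [h]
  have h := condExp_sub (integrable_const (1 : ℝ)) (integrable_indicator_one μ hm) (ℱ i)
  rw [condExp_const (ℱ.le i)] at h
  unfold condProb
  rw [e]
  filter_upwards [h] with ω h using h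

/-- Given the past, the indicator of the next event may be replaced by its conditional probability
r, because the other factors, including e^{tr}, are already determined. Each new factor thus has
conditional mean e^{tr}(1-ru) ≤ M, and the estimate follows by induction. -/
theorem integral_prod_exp_condProb_le {t u M : ℝ} (ht : 0 ≤ t) (hu : u ≤ 1) (hM : 0 ≤ M)
    (h : ∀ r ∈ Set.Icc (0 : ℝ) 1, Real.exp (t * r) * (1 - r * u) ≤ M) (n : ℕ) :
    Integrable (fun ω => ∏ i ∈ Finset.range n, (Real.exp (t * condProb μ ℱ A i ω) *
        (1 - u * (A i).indicator (fun _ => (1 : ℝ)) ω))) μ ∧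
    ∫ ω, ∏ i ∈ Finset.range n, (Real.exp (t * condProb μ ℱ A i ω) *
        (1 - u * (A i).indicator (fun _ => (1 : ℝ)) ω)) ∂μ ≤ M ^ n := by
  let Y : ℕ → Ω → ℝ := fun n ω => ∏ i ∈ Finset.range n, (Real.exp (t * condProb μ ℱ A i ω) *
        (1 - u * (A i).indicator (fun _ => (1 : ℝ)) ω))
  have hYm : ∀ n, StronglyMeasurable[ℱ n] (Y n) := by
    intro n
    refine Finset.stronglyMeasurable_fun_prod _ fun i hi => ?_
    have hi' : i + 1 ≤ n := Finset.mem_range.1 hi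
    have h1 : StronglyMeasurable[ℱ n] (condProb μ ℱ A i) :=
      stronglyMeasurable_condExp.mono (ℱ.mono (by omega))
    have h2 : StronglyMeasurable[ℱ n] ((A i).indicator (fun _ => (1 : ℝ))) :=
      stronglyMeasurable_const.indicator (ℱ.mono hi' _ (hA i))
    exact (Real.continuous_exp.comp_stronglyMeasurable (h1.const_mul t)).mul
      (stronglyMeasurable_const.sub (h2.const_mul u))
  have hfac : ∀ (ω : Ω) (i : ℕ), 0 ≤ 1 - u * (A i).indicator (fun _ => (1 : ℝ)) ω := by
    intro ω i
    obtain ⟨h1, h2⟩ := indicator_one_mem_Icc (A i) ω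
    nlinarith
  have hY0 : ∀ n ω, 0 ≤ Y n ω := fun n ω =>
    Finset.prod_nonneg fun i _ => mul_nonneg (Real.exp_pos _).le (hfac ω i)
  have hC : ∀ᵐ ω ∂μ, ∀ n, |Y n ω| ≤ (Real.exp t * (1 + |u|)) ^ n := by
    filter_upwards [ae_all_iff.2 (condProb_mem_Icc μ ℱ hA)] with ω hω n
    rw [abs_of_nonneg (hY0 n ω)]
    refine (Finset.prod_le_prod (fun i _ => mul_nonneg (Real.exp_pos _).le (hfac ω i))
      (g := fun _ => Real.exp t * (1 + |u|)) fun i _ => ?_).trans (by simp)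
    obtain ⟨h1, h2⟩ := indicator_one_mem_Icc (A i) ω
    have h3 : -u * (A i).indicator (fun _ => (1 : ℝ)) ω ≤ |u| := by
      have := neg_abs_le u
      nlinarith [abs_nonneg u]
    refine mul_le_mul (Real.exp_le_exp.2 ?_) (by linarith) (hfac ω i) (Real.exp_pos _).le
    nlinarith [(hω i).2]
  have hYi : ∀ n, Integrable (Y n) μ := fun n =>
    Integrable.of_bound ((hYm n).mono (ℱ.le n)).aestronglyMeasurable
      ((Real.exp t * (1 + |u|)) ^ n) (by filter_upwards [hC] with ω hω using hω n)
  refine ⟨hYi n, ?_⟩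
  change ∫ ω, Y n ω ∂μ ≤ _
  induction n with
  | zero => simp [Y]
  | succ n ih =>
    let g : Ω → ℝ := fun ω => Y n ω * Real.exp (t * condProb μ ℱ A n ω)
    let ξ : Ω → ℝ := (A n).indicator (fun _ => (1 : ℝ))
    have hpm : StronglyMeasurable[ℱ n] (condProb μ ℱ A n) := stronglyMeasurable_condExp
    have hgm : StronglyMeasurable[ℱ n] g :=
      (hYm n).mul (Real.continuous_exp.comp_stronglyMeasurable (hpm.const_mul t))
    have hgb : ∀ᵐ ω ∂μ, ‖g ω‖ ≤ (Real.exp t * (1 + |u|)) ^ n * Real.exp t := by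
      filter_upwards [hC, condProb_mem_Icc μ ℱ hA n] with ω hω hp
      simp only [g]
      rw [norm_mul, Real.norm_eq_abs, Real.norm_eq_abs, Real.abs_exp]
      refine mul_le_mul (hω n) (Real.exp_le_exp.2 ?_) (Real.exp_pos _).le (by positivity)
      nlinarith [hp.2]
    have hmA : MeasurableSet (A n) := ℱ.le _ _ (hA n)
    have hξi : Integrable ξ μ := integrable_indicator_one μ hmA
    have hga : AEStronglyMeasurable g μ := (hgm.mono (ℱ.le n)).aestronglyMeasurable
    have hgi : Integrable g μ := Integrable.of_bound hga _ hgb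
    have hgξ : Integrable (g * ξ) μ := hξi.bdd_mul hga hgb
    have hgp : Integrable (g * condProb μ ℱ A n) μ := integrable_condExp.bdd_mul hga hgb
    have hint : ∫ ω, (g * ξ) ω ∂μ = ∫ ω, (g * condProb μ ℱ A n) ω ∂μ := by
      rw [← integral_condExp (ℱ.le n)]
      exact integral_congr_ae (condExp_mul_of_stronglyMeasurable_left hgm hgξ hξi)
    have e1 : ∫ ω, Y (n + 1) ω ∂μ = ∫ ω, g ω ∂μ - u * ∫ ω, (g * ξ) ω ∂μ := by
      rw [← integral_const_mul, ← integral_sub hgi (hgξ.const_mul u)]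
      refine integral_congr_ae (Filter.Eventually.of_forall fun ω => ?_)
      simp only [Y, g, ξ, Finset.prod_range_succ, Pi.mul_apply]
      ring
    have e2 : ∫ ω, g ω ∂μ - u * ∫ ω, (g * condProb μ ℱ A n) ω ∂μ ≤ ∫ ω, M * Y n ω ∂μ := by
      rw [← integral_const_mul, ← integral_sub hgi (hgp.const_mul u)]
      refine integral_mono_ae (hgi.sub (hgp.const_mul u)) ((hYi n).const_mul M) ?_
      filter_upwards [condProb_mem_Icc μ ℱ hA n] with ω hp
      have := mul_le_mul_of_nonneg_left (h _ hp) (hY0 n ω)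
      simp only [g, Pi.mul_apply]
      linarith
    rw [e1, hint]
    refine e2.trans ?_
    rw [integral_const_mul, pow_succ']
    exact mul_le_mul_of_nonneg_left ih hM

/-- Kato's inequality. -/
theorem kato_upper {n : ℕ} (hn : 0 < n) {α β l : ℝ} (hl : 0 < l) (hβ : 0 ≤ β)
    (hαβ : 2 * n * (β ^ 2 - α ^ 2) = (1 + 4 * α / 3) ^ 2 * l) :
    μ {ω | n * (β - α) + (1 + 2 * α) * countOf A n ω < ∑ i ∈ Finset.range n, condProb μ ℱ A i ω} ≤
      ENNReal.ofReal (Real.exp (-l)) := by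
  have hn' : (0 : ℝ) < n := Nat.cast_pos.2 hn
  have habs : |α| ≤ β := by
    refine abs_le_of_sq_le_sq ?_ hβ
    have : 0 ≤ 2 * n * (β ^ 2 - α ^ 2) := by rw [hαβ]; positivity
    have := nonneg_of_mul_nonneg_right this (by positivity)
    linarith
  obtain ⟨hα1, hα2⟩ := abs_le.1 habs
  -- Here the coefficient 1+2α is nonpositive, so the threshold is at least n(1+α+β) ≥ n, which the
  -- sum of conditional probabilities cannot exceed.
  by_cases hαhalf : α ≤ -(1 / 2)
  · refine le_trans (le_of_eq ?_) zero_le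
    rw [measure_eq_zero_iff_ae_notMem]
    filter_upwards [sum_condProb_le μ ℱ hA n] with ω hω
    have := (countOf_mem_Icc A n ω).2
    refine not_lt.2 ?_
    nlinarith
  -- Here n(β-α) ≥ n alone makes the event null.
  by_cases hβ1 : 1 + α ≤ β
  · refine le_trans (le_of_eq ?_) zero_le
    rw [measure_eq_zero_iff_ae_notMem]
    filter_upwards [sum_condProb_le μ ℱ hA n] with ω hω
    have := (countOf_mem_Icc A n ω).1
    refine not_lt.2 ?_
    nlinarith
  push Not at hαhalf hβ1
  have hk : 0 < 1 + 4 * α / 3 := by linarith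
  have hlt : |α| < β := by
    refine lt_of_le_of_ne habs fun h => ?_
    rw [← h, sq_abs, sub_self, mul_zero] at hαβ
    exact (mul_pos (pow_pos hk 2) hl).ne hαβ
  have hexp : 2 * (β ^ 2 - α ^ 2) / (1 + 4 * α / 3) ^ 2 = l / n := by
    rw [div_eq_div_iff (by positivity) hn'.ne']
    linarith
  obtain ⟨t, ht, hmgf⟩ := exists_kato_mgf hlt hβ1
  rw [hexp] at hmgf
  obtain ⟨hi, hle⟩ := integral_prod_exp_condProb_le μ ℱ hA ht.le
    (u := 1 - Real.exp (-(t * (1 + 2 * α)))) (by linarith [Real.exp_pos (-(t * (1 + 2 * α)))])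
    (Real.exp_pos _).le hmgf n
  have hprod : ∀ ω, ∏ i ∈ Finset.range n, (Real.exp (t * condProb μ ℱ A i ω) *
      (1 - (1 - Real.exp (-(t * (1 + 2 * α)))) * (A i).indicator (fun _ => (1 : ℝ)) ω)) =
      Real.exp (t * (∑ i ∈ Finset.range n, condProb μ ℱ A i ω -
        (1 + 2 * α) * countOf A n ω)) := by
    intro ω
    rw [countOf, Finset.mul_sum, ← Finset.sum_sub_distrib, Finset.mul_sum, Real.exp_sum]
    refine Finset.prod_congr rfl fun i _ => ?_
    by_cases h : ω ∈ A i
    · simp only [h, Set.indicator_of_mem, mul_one, sub_sub_cancel, ← Real.exp_add]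
      congr 1
      ring
    · simp [h]
  simp_rw [hprod] at hi hle
  have hmarkov := mul_meas_ge_le_integral_of_nonneg
    (Filter.Eventually.of_forall fun ω => (Real.exp_pos _).le) hi (Real.exp (t * (n * (β - α))))
  have hfin : μ.real {ω | Real.exp (t * (n * (β - α))) ≤ Real.exp (t *
      (∑ i ∈ Finset.range n, condProb μ ℱ A i ω - (1 + 2 * α) * countOf A n ω))} ≤
      Real.exp (-l) := by
    have h1 := hmarkov.trans hle
    rw [← Real.exp_nat_mul] at h1
    have h2 : (n : ℝ) * (t * (β - α) - l / n) = t * (n * (β - α)) + -l := by field_simp; ring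
    rw [h2, Real.exp_add] at h1
    exact le_of_mul_le_mul_left h1 (Real.exp_pos _)
  refine le_trans (measure_mono ?_) (ENNReal.le_ofReal_iff_toReal_le (measure_ne_top _ _)
    (Real.exp_pos _).le |>.2 hfin)
  intro ω hω
  rw [Set.mem_ofPred_eq] at hω ⊢
  refine Real.exp_le_exp.2 (mul_le_mul_of_nonneg_left ?_ ht.le)
  linarith

/-- This is `kato_upper` for the complementary events with -α for α: count and sum of conditional
probabilities are both replaced by n minus themselves. -/
theorem kato_lower {n : ℕ} (hn : 0 < n) {α β l : ℝ} (hl : 0 < l) (hβ : 0 ≤ β)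
    (hαβ : 2 * n * (β ^ 2 - α ^ 2) = (1 - 4 * α / 3) ^ 2 * l) :
    μ {ω | ∑ i ∈ Finset.range n, condProb μ ℱ A i ω <
      (1 - 2 * α) * countOf A n ω - n * (β - α)} ≤ ENNReal.ofReal (Real.exp (-l)) := by
  have h := kato_upper μ ℱ (A := fun i => (A i)ᶜ) (fun i => (hA i).compl) hn (α := -α) hl hβ
    (by rw [neg_sq, hαβ]; ring)
  refine le_trans (measure_mono_ae ?_) h
  filter_upwards [ae_all_iff.2 (condProb_compl μ ℱ hA)] with ω hω hmem
  change _ < _ at hmem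
  change _ < _
  simp only [hω, countOf_compl, Finset.sum_sub_distrib, Finset.sum_const, Finset.card_range,
    nsmul_eq_mul, mul_one]
  nlinarith

-- With α = a/√n and β = b/√n, the definition of b from a is exactly the relation that Kato's
-- inequality requires, as 4a/√(9n) = 4α/3. This holds for every a: the closed forms of `aU` and
-- `aL`, and the estimate C in them, affect the sharpness of the bound and not its validity.
omit hA in
theorem kato_parameters {n : ℕ} (hn : 0 < n) (a l : ℝ) (hl : 0 < l) :
    2 * n * ((√(a ^ 2 + 1 / 2 * (1 + 4 * a / √(9 * n : ℝ)) ^ 2 * l) / √(n : ℝ)) ^ 2 -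
      (a / √(n : ℝ)) ^ 2) = (1 + 4 * (a / √(n : ℝ)) / 3) ^ 2 * l := by
  have hn' : (0 : ℝ) < n := Nat.cast_pos.2 hn
  have h9 : √(9 * n : ℝ) = 3 * √(n : ℝ) := by
    rw [Real.sqrt_mul (by norm_num), show (9 : ℝ) = 3 ^ 2 by norm_num, Real.sqrt_sq (by norm_num)]
  have hs := Real.sq_sqrt hn'.le
  have hs0 : 0 < √(n : ℝ) := Real.sqrt_pos.2 hn'
  rw [h9, div_pow, div_pow, Real.sq_sqrt (by positivity)]
  generalize √(n : ℝ) = s at *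
  rw [← hs]
  field_simp
  ring

/-- The sum of the conditional probabilities is at most the observed number plus `deltaU`. -/
theorem kato_deltaU {n : ℕ} (hn : 0 < n) {ε : ℝ} (h0 : 0 < ε) (h1 : ε < 1) (C : ℝ) :
    μ {ω | countOf A n ω + deltaU (countOf A n ω) C n ε <
      ∑ i ∈ Finset.range n, condProb μ ℱ A i ω} ≤ ENNReal.ofReal ε := by
  have hl : 0 < Real.log (1 / ε) := Real.log_pos (by rw [lt_div_iff₀ h0]; linarith)
  have h := kato_upper μ ℱ hA hn hl (α := aU n C ε / √(n : ℝ)) (β := bU n C ε / √(n : ℝ))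
    (div_nonneg (Real.sqrt_nonneg _) (Real.sqrt_nonneg _)) (kato_parameters hn _ _ hl)
  rw [one_div, Real.log_inv, neg_neg, Real.exp_log h0] at h
  convert h using 5 with ω
  have hn' : (0 : ℝ) < n := Nat.cast_pos.2 hn
  rw [deltaU]
  field_simp
  ring

/-- The sum of the conditional probabilities is at least the observed number minus `deltaL`. -/
theorem kato_deltaL {n : ℕ} (hn : 0 < n) {ε : ℝ} (h0 : 0 < ε) (h1 : ε < 1) (C : ℝ) :
    μ {ω | ∑ i ∈ Finset.range n, condProb μ ℱ A i ω <
      countOf A n ω - deltaL (countOf A n ω) C n ε} ≤ ENNReal.ofReal ε := by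
  have hl : 0 < Real.log (1 / ε) := Real.log_pos (by rw [lt_div_iff₀ h0]; linarith)
  -- `bL` arises from `aL` as `bU` does from `aU`, with the sign of a reversed.
  have hp := kato_parameters hn (-aL n C ε) _ hl
  have h := kato_lower μ ℱ hA hn hl (α := aL n C ε / √(n : ℝ)) (β := bL n C ε / √(n : ℝ))
    (div_nonneg (Real.sqrt_nonneg _) (Real.sqrt_nonneg _)) (by
      rw [bL]
      convert hp using 2 <;> ring_nf)
  rw [one_div, Real.log_inv, neg_neg, Real.exp_log h0] at h
  convert h using 5 with ω
  have hn' : (0 : ℝ) < n := Nat.cast_pos.2 hn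
  rw [deltaL]
  field_simp
  ring

end kato

open BasisLabel Intensity

/-! ### Bob's receiver in one round -/

section receiver

/-- Indicator of a detection on the line `ℓ` only, with a bit different from `s`. -/
def differOn (ℓ : BasisLabel) (s : Bool) (y : BobRecord) : ℝ :=
  if y.beta = some ℓ ∧ y.bitOn ℓ ≠ s then 1 else 0

/-- Indicator of a cross-click. -/
def crossInd (y : BobRecord) : ℝ :=
  if y.lineClicks Z = true ∧ y.lineClicks X = true then 1 else 0

/-- Indicator of the absence of detections on the line `ℓ`. -/
def silent (ℓ : BasisLabel) (y : BobRecord) : ℝ := if y.lineClicks ℓ = false then 1 else 0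

theorem differOn_nonneg (ℓ : BasisLabel) (s : Bool) (y : BobRecord) : 0 ≤ differOn ℓ s y := by
  unfold differOn; split_ifs <;> norm_num

theorem crossInd_nonneg (y : BobRecord) : 0 ≤ crossInd y := by
  unfold crossInd; split_ifs <;> norm_num

/-- Equality holds unless both lines are silent, when the left side is -1. Cross-clicks are thereby
bounded below through silences, which are easy to estimate. -/
theorem one_sub_silent_le_crossInd (y : BobRecord) :
    1 - silent Z y - silent X y ≤ crossInd y := by
  unfold silent crossInd
  cases y.lineClicks Z <;> cases y.lineClicks X <;> simp

theorem differOn_Z_le_silent (s : Bool) (y : BobRecord) : differOn Z s y ≤ silent X y := by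
  unfold silent differOn BobRecord.beta
  cases y.lineClicks Z <;> cases y.lineClicks X <;> simp
  split_ifs <;> norm_num

/-- The dark counts given by their values at the four detectors. -/
def darkEquiv : (Bool × Bool) × (Bool × Bool) ≃ (BasisLabel → Bool → Bool) where
  toFun t ℓ b := match ℓ, b with
    | Z, false => t.1.1
    | Z, true => t.1.2
    | X, false => t.2.1
    | X, true => t.2.2
  invFun e := ((e Z false, e Z true), (e X false, e X true))
  left_inv _ := rfl
  right_inv e := by funext ℓ b; cases ℓ <;> cases b <;> rfl

theorem sum_basisLabel {M : Type*} [AddCommMonoid M] (f : BasisLabel → M) :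
    ∑ ℓ, f ℓ = f Z + f X := by
  change ∑ ℓ ∈ ({Z, X} : Finset BasisLabel), f ℓ = _
  rw [Finset.sum_insert (by simp), Finset.sum_singleton]

theorem prod_basisLabel {M : Type*} [CommMonoid M] (f : BasisLabel → M) :
    ∏ ℓ, f ℓ = f Z * f X := by
  change ∏ ℓ ∈ ({Z, X} : Finset BasisLabel), f ℓ = _
  rw [Finset.prod_insert (by simp), Finset.prod_singleton]

/-- Expectation of `f` over the dark counts and the random bit. -/
def noiseMean (P : Params) (f : BobRecord → ℝ) (p p' : Ports) : ℝ :=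
  ∑ t : (BasisLabel → Bool → Bool) × Bool,
    noiseProb P ⟨p, p', t.1, t.2⟩ * f ⟨p, p', t.1, t.2⟩

theorem noiseMean_mono (P : Params) {f g : BobRecord → ℝ} (h : ∀ y, f y ≤ g y) (p p' : Ports) :
    noiseMean P f p p' ≤ noiseMean P g p p' :=
  Finset.sum_le_sum fun _ _ => mul_le_mul_of_nonneg_left (h _) (noiseProb_nonneg P _)

theorem noiseMean_nonneg (P : Params) {f : BobRecord → ℝ} (h : ∀ y, 0 ≤ f y) (p p' : Ports) :
    0 ≤ noiseMean P f p p' :=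
  Finset.sum_nonneg fun _ _ => mul_nonneg (noiseProb_nonneg P _) (h _)

theorem noiseMean_silent_le (P : Params) (ℓ : BasisLabel) (p p' : Ports) :
    noiseMean P (silent ℓ) p p' ≤ (1 - P.d) ^ 2 := by
  have hle : ∀ y : BobRecord,
      silent ℓ y ≤ if y.dark ℓ false = false ∧ y.dark ℓ true = false then 1 else 0 := by
    intro y
    unfold silent BobRecord.lineClicks BobRecord.clicks
    cases y.dark ℓ false <;> cases y.dark ℓ true <;> simp
    split_ifs <;> norm_num
  refine (noiseMean_mono P hle p p').trans (le_of_eq ?_)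
  unfold noiseMean noiseProb
  rw [Fintype.sum_prod_type, ← darkEquiv.sum_comp]
  simp only [Fintype.sum_prod_type, Fintype.sum_bool, prod_basisLabel, Fintype.prod_bool,
    darkEquiv, Equiv.coe_fn_mk]
  cases ℓ <;> simp <;> ring

theorem silent_eq_zero {ℓ : BasisLabel} {y : BobRecord} (h : ∃ b, 0 < y.photonsAt ℓ b) :
    silent ℓ y = 0 := by
  obtain ⟨b, hb⟩ := h
  unfold silent BobRecord.lineClicks BobRecord.clicks
  cases b <;> simp [hb]

/-! ### Symmetry between the two lines. -/

/-- The two lines exchanged. -/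
def Ports.swap (p : Ports) : Ports := ⟨p.lost, p.onX, p.onZ⟩

/-- The other line. -/
def BasisLabel.other : BasisLabel → BasisLabel
  | Z => X
  | X => Z

theorem BasisLabel.other_involutive : Function.Involutive BasisLabel.other := by
  intro ℓ; cases ℓ <;> rfl

/-- The two lines exchanged. -/
def BobRecord.swap (y : BobRecord) : BobRecord :=
  ⟨y.diag.swap, y.anti.swap, fun ℓ => y.dark ℓ.other, y.coin⟩

theorem BobRecord.clicks_swap (y : BobRecord) (ℓ : BasisLabel) (b : Bool) :
    y.swap.clicks ℓ b = y.clicks ℓ.other b := by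
  cases ℓ <;> cases b <;> rfl

theorem differOn_swap (s : Bool) (y : BobRecord) : differOn X s y.swap = differOn Z s y := by
  have h1 : ∀ ℓ : BasisLabel, y.swap.lineClicks ℓ = y.lineClicks ℓ.other := fun ℓ => by
    simp only [BobRecord.lineClicks, BobRecord.clicks_swap]
  have h2 : y.swap.bitOn X = y.bitOn Z := by
    simp only [BobRecord.bitOn, BobRecord.clicks_swap, BasisLabel.other]
    rfl
  unfold differOn BobRecord.beta
  rw [h2, h1, h1]
  simp only [BasisLabel.other]
  rcases Bool.eq_false_or_eq_true (y.lineClicks Z) with hZ | hZ <;>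
    rcases Bool.eq_false_or_eq_true (y.lineClicks X) with hX | hX <;> simp [hZ, hX]

theorem noiseProb_swap (P : Params) (y : BobRecord) : noiseProb P y.swap = noiseProb P y := by
  unfold noiseProb
  rw [prod_basisLabel, prod_basisLabel]
  exact congrArg (· * (1 / 2)) (mul_comm _ _)

/-- Both lines measure the same polarization with identical detectors, so an error is equally likely
once the photons have all gone to one line or all to the other. This is what allows `X` errors to
stand for `Z` errors. -/
theorem noiseMean_differOn_swap (P : Params) (s : Bool) (p p' : Ports) :
    noiseMean P (differOn X s) p.swap p'.swap = noiseMean P (differOn Z s) p p' := by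
  unfold noiseMean
  refine (Equiv.sum_comp (Equiv.prodCongr (Equiv.arrowCongr
    (Function.Involutive.toPerm _ BasisLabel.other_involutive) (Equiv.refl _)) (Equiv.refl _))
    _).symm.trans ?_
  refine Finset.sum_congr rfl fun t _ => ?_
  have e : (⟨p.swap, p'.swap, fun ℓ => t.1 ℓ.other, t.2⟩ : BobRecord) =
    BobRecord.swap ⟨p, p', t.1, t.2⟩ := rfl
  change noiseProb P ⟨p.swap, p'.swap, fun ℓ => t.1 ℓ.other, t.2⟩ *
    differOn X s ⟨p.swap, p'.swap, fun ℓ => t.1 ℓ.other, t.2⟩ = _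
  rw [e, noiseProb_swap, differOn_swap]

/-! ### Averages over the beam splitter at fixed numbers of surviving photons. -/

/-- Expectation of `f` given the photons of the two modes that are lost and that are not. -/
def receiverMean (P : Params) (f : BobRecord → ℝ) (l l' j j' : ℕ) : ℝ :=
  ∑ a ∈ Finset.HasAntidiagonal.antidiagonal j, ∑ b ∈ Finset.HasAntidiagonal.antidiagonal j',
    bsAmp P.q a.1 a.2 ^ 2 * bsAmp P.q b.1 b.2 ^ 2 *
      noiseMean P f ⟨l, a.2, a.1⟩ ⟨l', b.2, b.1⟩

theorem bsAmp_sq {t : ℝ} (h0 : 0 ≤ t) (h1 : t ≤ 1) (a b : ℕ) :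
    bsAmp t a b ^ 2 = ((a + b).choose a : ℝ) * t ^ a * (1 - t) ^ b := by
  have : 0 ≤ 1 - t := by linarith
  exact Real.sq_sqrt (by positivity)

theorem receiverMean_nonneg (P : Params) {f : BobRecord → ℝ} (h : ∀ y, 0 ≤ f y) (l l' j j' : ℕ) :
    0 ≤ receiverMean P f l l' j j' :=
  Finset.sum_nonneg fun _ _ => Finset.sum_nonneg fun _ _ =>
    mul_nonneg (by positivity) (noiseMean_nonneg P h _ _)

theorem noiseMean_eq_zero (P : Params) {f : BobRecord → ℝ} {p p' : Ports}
    (h : ∀ e c, f ⟨p, p', e, c⟩ = 0) : noiseMean P f p p' = 0 :=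
  Finset.sum_eq_zero fun t _ => by rw [h, mul_zero]

/-- If `f` vanishes unless all the photons are on the `Z` line. -/
theorem receiverMean_of_allZ (P : Params) {f : BobRecord → ℝ}
    (h : ∀ y, (∃ b, 0 < y.photonsAt X b) → f y = 0) (l l' j j' : ℕ) :
    receiverMean P f l l' j j' = (1 - P.q) ^ (j + j') * noiseMean P f ⟨l, j, 0⟩ ⟨l', j', 0⟩ := by
  have hq := P.q_pos
  have hq' := P.q_lt
  unfold receiverMean
  -- The first component counts the photons transmitted to the `X` line, so only (0, j) and (0, j')
  -- put no photon there.
  rw [Finset.sum_eq_single (0, j), Finset.sum_eq_single (0, j')]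
  · simp only [bsAmp_sq hq.le (by linarith : P.q ≤ 1), pow_add]
    simp
  · rintro ⟨x, z⟩ hb hne
    rw [noiseMean_eq_zero P, mul_zero]
    intro e c
    refine h _ ⟨true, Nat.pos_of_ne_zero fun h0 => hne ?_⟩
    rw [Finset.HasAntidiagonal.mem_antidiagonal] at hb
    simp only [BobRecord.photonsAt] at h0 hb
    simp only [Prod.mk.injEq]
    omega
  · intro hb
    exact absurd (by simp) hb
  · rintro ⟨x, z⟩ hb hne
    refine Finset.sum_eq_zero fun b _ => ?_
    rw [noiseMean_eq_zero P, mul_zero]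
    intro e c
    refine h _ ⟨false, Nat.pos_of_ne_zero fun h0 => hne ?_⟩
    rw [Finset.HasAntidiagonal.mem_antidiagonal] at hb
    simp only [BobRecord.photonsAt] at h0 hb
    simp only [Prod.mk.injEq]
    omega
  · intro hb
    exact absurd (by simp) hb

/-- If `f` vanishes unless all the photons are on the `X` line. -/
theorem receiverMean_of_allX (P : Params) {f : BobRecord → ℝ}
    (h : ∀ y, (∃ b, 0 < y.photonsAt Z b) → f y = 0) (l l' j j' : ℕ) :
    receiverMean P f l l' j j' = P.q ^ (j + j') * noiseMean P f ⟨l, 0, j⟩ ⟨l', 0, j'⟩ := by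
  have hq := P.q_pos
  have hq' := P.q_lt
  unfold receiverMean
  rw [Finset.sum_eq_single (j, 0), Finset.sum_eq_single (j', 0)]
  · simp only [bsAmp_sq hq.le (by linarith : P.q ≤ 1), pow_add]
    simp
  · rintro ⟨x, z⟩ hb hne
    rw [noiseMean_eq_zero P, mul_zero]
    intro e c
    refine h _ ⟨true, Nat.pos_of_ne_zero fun h0 => hne ?_⟩
    rw [Finset.HasAntidiagonal.mem_antidiagonal] at hb
    simp only [BobRecord.photonsAt] at h0 hb
    simp only [Prod.mk.injEq]
    omega
  · intro hb
    exact absurd (by simp) hb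
  · rintro ⟨x, z⟩ hb hne
    refine Finset.sum_eq_zero fun b _ => ?_
    rw [noiseMean_eq_zero P, mul_zero]
    intro e c
    refine h _ ⟨false, Nat.pos_of_ne_zero fun h0 => hne ?_⟩
    rw [Finset.HasAntidiagonal.mem_antidiagonal] at hb
    simp only [BobRecord.photonsAt] at h0 hb
    simp only [Prod.mk.injEq]
    omega
  · intro hb
    exact absurd (by simp) hb

theorem differOn_Z_eq_zero {s : Bool} {y : BobRecord} (h : ∃ b, 0 < y.photonsAt X b) :
    differOn Z s y = 0 :=
  le_antisymm ((differOn_Z_le_silent s y).trans (silent_eq_zero h).le) (differOn_nonneg _ _ _)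

theorem differOn_X_eq_zero {s : Bool} {y : BobRecord} (h : ∃ b, 0 < y.photonsAt Z b) :
    differOn X s y = 0 := by
  have e : differOn X s y = differOn Z s y.swap := by rw [← differOn_swap]; rfl
  rw [e]
  obtain ⟨b, hb⟩ := h
  exact differOn_Z_eq_zero ⟨b, by cases b <;> exact hb⟩

theorem receiverMean_mono (P : Params) {f g : BobRecord → ℝ} (h : ∀ y, f y ≤ g y)
    (l l' j j' : ℕ) : receiverMean P f l l' j j' ≤ receiverMean P g l l' j j' :=
  Finset.sum_le_sum fun _ _ => Finset.sum_le_sum fun _ _ =>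
    mul_le_mul_of_nonneg_left (noiseMean_mono P h _ _) (by positivity)

theorem sum_bsAmp_sq {t : ℝ} (h0 : 0 ≤ t) (h1 : t ≤ 1) (j : ℕ) :
    ∑ a ∈ Finset.HasAntidiagonal.antidiagonal j, bsAmp t a.1 a.2 ^ 2 = 1 := by
  have h := (Commute.all t (1 - t)).add_pow' j
  rw [add_sub_cancel, one_pow] at h
  rw [h]
  refine Finset.sum_congr rfl fun a ha => ?_
  rw [Finset.HasAntidiagonal.mem_antidiagonal] at ha
  rw [bsAmp_sq h0 h1, ha, nsmul_eq_mul, mul_assoc]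

theorem receiverMean_one_sub (P : Params) (l l' j j' : ℕ) (f g : BobRecord → ℝ) :
    receiverMean P (fun y => 1 - f y - g y) l l' j j' =
      1 - receiverMean P f l l' j j' - receiverMean P g l l' j j' := by
  have hq := P.q_pos
  have hq' := P.q_lt
  have h1 : ∑ a ∈ Finset.HasAntidiagonal.antidiagonal j,
      ∑ b ∈ Finset.HasAntidiagonal.antidiagonal j',
        bsAmp P.q a.1 a.2 ^ 2 * bsAmp P.q b.1 b.2 ^ 2 = 1 := by
    simp_rw [← Finset.mul_sum, sum_bsAmp_sq hq.le (by linarith : P.q ≤ 1), mul_one,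
      sum_bsAmp_sq hq.le (by linarith : P.q ≤ 1)]
  have h2 : ∀ p p', noiseMean P (fun y => 1 - f y - g y) p p' =
      1 - noiseMean P f p p' - noiseMean P g p p' := by
    intro p p'
    refine Eq.trans ?_ (congrArg (· - _ - _) (sum_noiseProb P p p'))
    simp only [noiseMean, ← Finset.sum_sub_distrib]
    refine Finset.sum_congr rfl fun t _ => ?_
    ring
  unfold receiverMean
  simp_rw [h2]
  refine Eq.trans ?_ (congrArg (· - _ - _) h1)
  simp only [← Finset.sum_sub_distrib]
  refine Finset.sum_congr rfl fun a _ => Finset.sum_congr rfl fun b _ => ?_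
  ring

/-- A line is silent only if all photons go to the other one and neither of its detectors has a dark
count. -/
theorem one_sub_le_receiverMean_crossInd (P : Params) (l l' j j' : ℕ) :
    1 - ((1 - P.q) ^ (j + j') + P.q ^ (j + j')) * (1 - P.d) ^ 2 ≤
      receiverMean P crossInd l l' j j' := by
  have hq := P.q_pos
  have hq' := P.q_lt
  have hq1 : 0 ≤ 1 - P.q := by linarith
  refine le_trans ?_ (receiverMean_mono P one_sub_silent_le_crossInd l l' j j')
  rw [receiverMean_one_sub, receiverMean_of_allX P (f := silent Z) (fun y => silent_eq_zero),
    receiverMean_of_allZ P (f := silent X) (fun y => silent_eq_zero)]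
  have h1 := mul_le_mul_of_nonneg_left (noiseMean_silent_le P Z ⟨l, 0, j⟩ ⟨l', 0, j'⟩)
    (pow_nonneg hq.le (j + j'))
  have h2 := mul_le_mul_of_nonneg_left (noiseMean_silent_le P X ⟨l, j, 0⟩ ⟨l', j', 0⟩)
    (pow_nonneg hq1 (j + j'))
  linarith

/-- The next difference is (1-q) times the current one plus q^(m+1)(1-2q); as q^(m+1) ≤ q, the
weights add up to at most 1. -/
theorem one_sub_pow_sub_pow_le {q : ℝ} (h0 : 0 ≤ q) (h1 : q ≤ 1 / 2) (m : ℕ) :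
    (1 - q) ^ (m + 1) - q ^ (m + 1) ≤ 1 - 2 * q := by
  induction m with
  | zero => simp; linarith
  | succ m ih =>
    have e : (1 - q) ^ (m + 2) - q ^ (m + 2) = (1 - q) * ((1 - q) ^ (m + 1) - q ^ (m + 1)) +
        q ^ (m + 1) * (1 - 2 * q) := by ring
    rw [e]
    have h2 : q ^ (m + 1) ≤ q := by
      rw [pow_succ]
      have := pow_le_one₀ h0 (by linarith : q ≤ 1) (n := m)
      nlinarith
    have h3 := mul_le_mul_of_nonneg_left ih (by linarith : 0 ≤ 1 - q)
    nlinarith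

theorem Params.cross_denominator_pos (P : Params) :
    0 < 1 - (P.q ^ 2 + (1 - P.q) ^ 2) * (1 - P.d) ^ 2 := by
  have hq := P.q_pos
  have hq' := P.q_lt
  have h1 : (1 - P.d) ^ 2 ≤ 1 := by
    have := P.d_nonneg
    have := P.d_lt
    nlinarith
  have h2 : P.q ^ 2 + (1 - P.q) ^ 2 < 1 := by nlinarith
  nlinarith [sq_nonneg P.q, sq_nonneg (1 - P.q)]

theorem Params.c₁_nonneg (P : Params) : 0 ≤ P.c₁ := by
  have hq := P.q_pos
  have hq' := P.q_lt
  have := P.pBasis_pos Z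
  have := P.pBasis_pos X
  have : 0 ≤ 1 - P.q := by linarith
  unfold Params.c₁
  positivity

theorem Params.c₂_nonneg (P : Params) : 0 ≤ P.c₂ := by
  have hq := P.q_pos
  have hq' := P.q_lt
  have := P.pBasis_pos Z
  have : 0 ≤ 1 - P.q := by linarith
  have : 0 ≤ 1 - 2 * P.q := by linarith
  have := P.cross_denominator_pos
  unfold Params.c₂
  positivity

/-- Errors on the `Z` line against errors on the `X` line and cross-clicks, given the photons that
are not lost. -/
theorem receiverMean_differOn_le (P : Params) (s : Bool) (l l' j j' : ℕ) :
    P.pBasis Z * receiverMean P (differOn Z s) l l' j j' ≤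
      P.c₁ * (P.pBasis X * receiverMean P (differOn X s) l l' j j') +
        P.c₂ * receiverMean P crossInd l l' j j' := by
  have hq := P.q_pos
  have hq' := P.q_lt
  have hZ := P.pBasis_pos Z
  have hX := P.pBasis_pos X
  have hCnn := receiverMean_nonneg P crossInd_nonneg l l' j j'
  have hC := one_sub_le_receiverMean_crossInd P l l' j j'
  rw [receiverMean_of_allZ P (f := differOn Z s) (fun y => differOn_Z_eq_zero),
    receiverMean_of_allX P (f := differOn X s) (fun y => differOn_X_eq_zero)]
  have hswap : noiseMean P (differOn X s) ⟨l, 0, j⟩ ⟨l', 0, j'⟩ =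
    noiseMean P (differOn Z s) ⟨l, j, 0⟩ ⟨l', j', 0⟩ :=
    noiseMean_differOn_swap P s ⟨l, j, 0⟩ ⟨l', j', 0⟩
  rw [hswap]
  have hB0 := noiseMean_nonneg P (differOn_nonneg Z s) ⟨l, j, 0⟩ ⟨l', j', 0⟩
  have hB1 := (noiseMean_mono P (differOn_Z_le_silent s) ⟨l, j, 0⟩ ⟨l', j', 0⟩).trans
    (noiseMean_silent_le P X _ _)
  generalize noiseMean P (differOn Z s) ⟨l, j, 0⟩ ⟨l', j', 0⟩ = B at *
  generalize receiverMean P crossInd l l' j j' = R at *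
  have hc₁ : P.c₁ * (P.pBasis X * (P.q ^ (j + j') * B)) =
      P.pBasis Z * ((1 - P.q) / P.q * P.q ^ (j + j') * B) := by
    unfold Params.c₁
    field_simp
  rw [hc₁]
  have hc₂ := P.c₂_nonneg
  rcases Nat.lt_or_ge (j + j') 2 with hj | hj
  -- With no photon the claim is 1 ≤ (1-q)/q, which is where q < 1/2 is needed; with one photon it
  -- is an equality. Cross-clicks are not needed here.
  · have : (1 - P.q) ^ (j + j') ≤ (1 - P.q) / P.q * P.q ^ (j + j') := by
      interval_cases j + j'
      · rw [pow_zero, pow_zero, mul_one, le_div_iff₀ hq]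
        linarith
      · rw [pow_one, pow_one, div_mul_cancel₀ _ hq.ne']
    have h1 := mul_le_mul_of_nonneg_left (mul_le_mul_of_nonneg_right this hB0) hZ.le
    have h2 := mul_nonneg hc₂ hCnn
    linarith
  -- From two photons on, `X` errors fall short of `Z` errors by (1-q)((1-q)^(m+1) - q^(m+1))B,
  -- where m is the excess over two. The cross-click probability is bounded below by its value at
  -- two photons, the denominator of `c₂`.
  · obtain ⟨m, hm⟩ := Nat.exists_eq_add_of_le' hj
    rw [hm] at hC ⊢
    have hden := P.cross_denominator_pos
    have h1 := one_sub_pow_sub_pow_le hq.le hq'.le m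
    have e : (1 - P.q) / P.q * P.q ^ (m + 2) = (1 - P.q) * P.q ^ (m + 1) := by
      field_simp
      ring
    have hR : 1 - (P.q ^ 2 + (1 - P.q) ^ 2) * (1 - P.d) ^ 2 ≤ R := by
      refine le_trans ?_ hC
      have h3 : (1 - P.q) ^ (m + 2) ≤ (1 - P.q) ^ 2 :=
        pow_le_pow_of_le_one (by linarith) (by linarith) (by omega)
      have h4 : P.q ^ (m + 2) ≤ P.q ^ 2 :=
        pow_le_pow_of_le_one (by linarith) (by linarith) (by omega)
      have := mul_le_mul_of_nonneg_right (add_le_add h3 h4) (sq_nonneg (1 - P.d))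
      linarith
    have hc : P.c₂ * (1 - (P.q ^ 2 + (1 - P.q) ^ 2) * (1 - P.d) ^ 2) =
        P.pBasis Z * (1 - P.q) * (1 - 2 * P.q) * (1 - P.d) ^ 2 := by
      unfold Params.c₂
      rw [div_mul_cancel₀ _ hden.ne']
    have h5 := mul_le_mul_of_nonneg_left hR hc₂
    rw [hc] at h5
    have h6 : ((1 - P.q) ^ (m + 1) - P.q ^ (m + 1)) * B ≤ (1 - 2 * P.q) * (1 - P.d) ^ 2 :=
      (mul_le_mul_of_nonneg_right h1 hB0).trans
        (mul_le_mul_of_nonneg_left hB1 (by linarith))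
    have h7 := mul_le_mul_of_nonneg_left h6
      (mul_nonneg hZ.le (by linarith : (0 : ℝ) ≤ 1 - P.q))
    rw [e]
    have e2 : (1 - P.q) ^ (m + 2) = (1 - P.q) * (1 - P.q) ^ (m + 1) := by ring
    rw [e2]
    linarith

/-! ### Summation over Bob's records. -/

theorem tsum_eq_tsum_antidiagonal (F : ℕ × ℕ → ℝ≥0∞) :
    ∑' t, F t = ∑' j, ∑ a ∈ Finset.HasAntidiagonal.antidiagonal j, F a := by
  rw [← Finset.HasAntidiagonal.sigmaAntidiagonalEquivProd.tsum_eq, ENNReal.tsum_sigma']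
  refine tsum_congr fun j => ?_
  rw [← Finset.tsum_subtype]
  rfl

theorem tsum_ports (F : Ports → ℝ≥0∞) :
    ∑' p, F p = ∑' l, ∑' j, ∑ a ∈ Finset.HasAntidiagonal.antidiagonal j, F ⟨l, a.2, a.1⟩ := by
  rw [← portsEquiv.tsum_eq]
  refine (ENNReal.tsum_prod (f := fun l (t : ℕ × ℕ) => F ⟨l, t.2, t.1⟩)).trans ?_
  exact tsum_congr fun l => tsum_eq_tsum_antidiagonal fun t => F ⟨l, t.2, t.1⟩

theorem tsum_bobRecord (F : BobRecord → ℝ≥0∞) :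
    ∑' y, F y = ∑' l, ∑' j, ∑' l', ∑' j',
      ∑ a ∈ Finset.HasAntidiagonal.antidiagonal j, ∑ b ∈ Finset.HasAntidiagonal.antidiagonal j',
        ∑ t : (BasisLabel → Bool → Bool) × Bool,
          F ⟨⟨l, a.2, a.1⟩, ⟨l', b.2, b.1⟩, t.1, t.2⟩ := by
  rw [← bobEquiv.tsum_eq]
  refine (ENNReal.tsum_prod (f := fun p (t : Ports × (BasisLabel → Bool → Bool) × Bool) =>
    F ⟨p, t.1, t.2.1, t.2.2⟩)).trans ?_
  rw [tsum_ports]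
  refine tsum_congr fun l => tsum_congr fun j => ?_
  have h : ∀ p, ∑' t : Ports × (BasisLabel → Bool → Bool) × Bool, F ⟨p, t.1, t.2.1, t.2.2⟩ =
      ∑' l', ∑' j', ∑ b ∈ Finset.HasAntidiagonal.antidiagonal j',
        ∑ t : (BasisLabel → Bool → Bool) × Bool, F ⟨p, ⟨l', b.2, b.1⟩, t.1, t.2⟩ := by
    intro p
    refine (ENNReal.tsum_prod (f := fun p' (t : (BasisLabel → Bool → Bool) × Bool) =>
      F ⟨p, p', t.1, t.2⟩)).trans ?_
    simp_rw [tsum_fintype]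
    rw [tsum_ports]
  simp_rw [h]
  rw [← Summable.tsum_finsetSum fun _ _ => ENNReal.summable]
  refine tsum_congr fun l' => ?_
  rw [← Summable.tsum_finsetSum fun _ _ => ENNReal.summable]

/-- H sees only the photon numbers before the losses, so the sum splits into the numbers lost (l,
l') and kept (j, j') and, for each choice, the mean over beam splitter, dark counts and random bit.
An inequality between such means then holds for every H. -/
theorem tsum_mul_bobProb (P : Params) (H : ℕ × ℕ → ℝ≥0∞) {f : BobRecord → ℝ}
    (hf : ∀ y, 0 ≤ f y) :
    ∑' y : BobRecord, H y.incoming * ENNReal.ofReal (bobProb P y * f y) =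
      ∑' l, ∑' j, ∑' l', ∑' j', H (l + j, l' + j') *
        ENNReal.ofReal (bsAmp P.eta j l ^ 2 * bsAmp P.eta j' l' ^ 2) *
          ENNReal.ofReal (receiverMean P f l l' j j') := by
  rw [tsum_bobRecord]
  refine tsum_congr fun l => tsum_congr fun j => tsum_congr fun l' => tsum_congr fun j' => ?_
  rw [mul_assoc, ← ENNReal.ofReal_mul (by positivity), receiverMean, Finset.mul_sum,
    ENNReal.ofReal_sum_of_nonneg, Finset.mul_sum]
  · refine Finset.sum_congr rfl fun a ha => ?_
    rw [Finset.mul_sum, ENNReal.ofReal_sum_of_nonneg, Finset.mul_sum]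
    · refine Finset.sum_congr rfl fun b hb => ?_
      rw [noiseMean, Finset.mul_sum, Finset.mul_sum, ENNReal.ofReal_sum_of_nonneg, Finset.mul_sum]
      · refine Finset.sum_congr rfl fun t _ => ?_
        rw [Finset.HasAntidiagonal.mem_antidiagonal] at ha hb
        have ha' : a.2 + a.1 = j := by omega
        have hb' : b.2 + b.1 = j' := by omega
        simp only [BobRecord.incoming, Ports.total, bobProb, portAmp, ha', hb', ha, hb]
        congr 2
        ring
      · exact fun t _ => mul_nonneg (by positivity)
          (mul_nonneg (by positivity) (mul_nonneg (noiseProb_nonneg P _) (hf _)))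
    · exact fun b _ => mul_nonneg (by positivity)
        (mul_nonneg (by positivity) (noiseMean_nonneg P hf _ _))
  · exact fun a _ => mul_nonneg (by positivity) (Finset.sum_nonneg fun b _ =>
      mul_nonneg (by positivity) (noiseMean_nonneg P hf _ _))

/-- Errors on the `Z` line against errors on the `X` line and cross-clicks, for any distribution of
the photon numbers of the received pulse. -/
theorem tsum_differOn_le (P : Params) (s : Bool) (H : ℕ × ℕ → ℝ≥0∞) :
    ENNReal.ofReal (P.pBasis Z) *
        ∑' y : BobRecord, H y.incoming * ENNReal.ofReal (bobProb P y * differOn Z s y) ≤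
      ENNReal.ofReal P.c₁ * (ENNReal.ofReal (P.pBasis X) *
        ∑' y : BobRecord, H y.incoming * ENNReal.ofReal (bobProb P y * differOn X s y)) +
      ENNReal.ofReal P.c₂ *
        ∑' y : BobRecord, H y.incoming * ENNReal.ofReal (bobProb P y * crossInd y) := by
  rw [tsum_mul_bobProb P H (differOn_nonneg _ _), tsum_mul_bobProb P H (differOn_nonneg _ _),
    tsum_mul_bobProb P H crossInd_nonneg]
  simp_rw [← ENNReal.tsum_mul_left, ← ENNReal.tsum_add]
  refine ENNReal.tsum_le_tsum fun l => ENNReal.tsum_le_tsum fun j =>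
    ENNReal.tsum_le_tsum fun l' => ENNReal.tsum_le_tsum fun j' => ?_
  have h := ENNReal.ofReal_le_ofReal (receiverMean_differOn_le P s l l' j j')
  rw [ENNReal.ofReal_add (mul_nonneg P.c₁_nonneg (mul_nonneg (P.pBasis_pos X).le
      (receiverMean_nonneg P (differOn_nonneg _ _) _ _ _ _)))
      (mul_nonneg P.c₂_nonneg (receiverMean_nonneg P crossInd_nonneg _ _ _ _)),
    ENNReal.ofReal_mul (P.pBasis_pos Z).le, ENNReal.ofReal_mul P.c₁_nonneg,
    ENNReal.ofReal_mul (P.pBasis_pos X).le, ENNReal.ofReal_mul P.c₂_nonneg] at h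
  generalize H (l + j, l' + j') * ENNReal.ofReal (bsAmp P.eta j l ^ 2 * bsAmp P.eta j' l' ^ 2) = K
  calc _ = K * (ENNReal.ofReal (P.pBasis Z) *
        ENNReal.ofReal (receiverMean P (differOn Z s) l l' j j')) := by ring
    _ ≤ K * _ := mul_le_mul_right h K
    _ = _ := by ring

end receiver

/-! ### The decoy-state argument in one round -/

section decoy

/-- Probability of the label, the photon number and the basis of a record of Alice. -/
def sourceWeight (P : Params) (r : AliceRecord) : ℝ :=
  P.pInten r.inten * P.pPhoton r.inten r.photons * P.pBasis r.basis

theorem sourceWeight_nonneg (P : Params) (r : AliceRecord) : 0 ≤ sourceWeight P r :=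
  mul_nonneg (mul_nonneg (P.pInten_pos _).le (P.pPhoton_nonneg _ _)) (P.pBasis_pos _).le

theorem tsum_aliceRecord (F : AliceRecord → ℝ≥0∞) :
    ∑' x, F x = ∑ α, ∑ ω, ∑' n, ∑ s, F ⟨α, ω, n, s⟩ := by
  rw [← aliceEquiv.tsum_eq]
  refine (ENNReal.tsum_prod (f := fun α (t : Intensity × ℕ × Bool) =>
    F ⟨α, t.1, t.2.1, t.2.2⟩)).trans ?_
  rw [tsum_fintype]
  refine Finset.sum_congr rfl fun α _ => ?_
  refine (ENNReal.tsum_prod (f := fun ω (t : ℕ × Bool) => F ⟨α, ω, t.1, t.2⟩)).trans ?_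
  rw [tsum_fintype]
  refine Finset.sum_congr rfl fun ω _ => ?_
  refine (ENNReal.tsum_prod (f := fun n (s : Bool) => F ⟨α, ω, n, s⟩)).trans ?_
  exact tsum_congr fun n => tsum_fintype _

/-- Contribution of the label `ω` to the expectation of `g`. -/
def labelSum (P : Params) (g : BasisLabel → ℕ → Bool → ℝ≥0∞) (ω : Intensity) : ℝ≥0∞ :=
  ∑' x : AliceRecord, if x.inten = ω then
    ENNReal.ofReal (sourceWeight P x) * g x.basis x.photons x.bit else 0

/-- The yield of `g` given the photon number `n`. -/
def yield (P : Params) (g : BasisLabel → ℕ → Bool → ℝ≥0∞) (n : ℕ) : ℝ≥0∞ :=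
  ∑ α, ∑ s, ENNReal.ofReal (P.pBasis α) * g α n s

/-- As g does not see the label, the yields are common to all labels and only the Poisson weights
differ: the principle of decoy states. -/
theorem labelSum_eq (P : Params) (g : BasisLabel → ℕ → Bool → ℝ≥0∞) (ω : Intensity) :
    labelSum P g ω =
      ENNReal.ofReal (P.pInten ω) * ∑' n, ENNReal.ofReal (P.pPhoton ω n) * yield P g n := by
  rw [labelSum, tsum_aliceRecord]
  have h : ∀ α, ∑ ω', ∑' n, ∑ s : Bool, (if (⟨α, ω', n, s⟩ : AliceRecord).inten = ω then
      ENNReal.ofReal (sourceWeight P ⟨α, ω', n, s⟩) * g α n s else 0) =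
      ∑' n, ∑ s : Bool, ENNReal.ofReal (sourceWeight P ⟨α, ω, n, s⟩) * g α n s := by
    intro α
    rw [Finset.sum_eq_single ω]
    · simp
    · intro ω' _ hne
      simp [hne]
    · simp
  refine (Finset.sum_congr rfl fun α _ => h α).trans ?_
  rw [← Summable.tsum_finsetSum fun _ _ => ENNReal.summable, ← ENNReal.tsum_mul_left]
  refine tsum_congr fun n => ?_
  rw [yield, Finset.mul_sum, Finset.mul_sum]
  refine Finset.sum_congr rfl fun α _ => ?_
  rw [Finset.mul_sum, Finset.mul_sum]
  refine Finset.sum_congr rfl fun s _ => ?_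
  rw [sourceWeight, ENNReal.ofReal_mul (mul_nonneg (P.pInten_pos _).le (P.pPhoton_nonneg _ _)),
    ENNReal.ofReal_mul (P.pInten_pos _).le]
  ring

/-- Since μ_V = 0, the label `V` emits no photon, so it gives the yield at n = 0 exactly. -/
theorem labelSum_vacuum (P : Params) (g : BasisLabel → ℕ → Bool → ℝ≥0∞) :
    ENNReal.ofReal (1 / P.pInten V) * labelSum P g V = yield P g 0 := by
  rw [labelSum_eq, tsum_eq_single 0, ← mul_assoc,
    ← ENNReal.ofReal_mul (one_div_nonneg.2 (P.pInten_pos V).le),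
    one_div_mul_cancel (P.pInten_pos V).ne']
  · simp [Params.pPhoton, P.mu_V]
  · intro n hn
    simp [Params.pPhoton, P.mu_V, hn]

/-- The decoy-state bound on the yield of single photons. -/
theorem decoy_le (P : Params) (g : BasisLabel → ℕ → Bool → ℝ≥0∞) :
    ENNReal.ofReal (1 / P.pInten V) * labelSum P g V + ENNReal.ofReal (P.mu D) * yield P g 1 ≤
      ENNReal.ofReal (Real.exp (P.mu D) / P.pInten D) * labelSum P g D := by
  have hD := P.pInten_pos D
  have hmu := P.mu_D_pos
  rw [labelSum_vacuum, labelSum_eq, ← mul_assoc, ← ENNReal.ofReal_mul (by positivity),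
    div_mul_cancel₀ _ hD.ne', ← ENNReal.tsum_mul_left]
  -- Only n = 0 and n = 1 are kept; the factor e^{μ_D} cancels the Poisson normalization and leaves
  -- weights 1 and μ_D.
  refine le_trans ?_ (ENNReal.sum_le_tsum (Finset.range 2))
  rw [Finset.sum_range_succ, Finset.sum_range_one, ← mul_assoc, ← mul_assoc,
    ← ENNReal.ofReal_mul (by positivity), ← ENNReal.ofReal_mul (by positivity)]
  simp [Params.pPhoton, ← mul_assoc, ← Real.exp_add]

/-! ### The events of a round and their weights. -/

/-- Phase errors with one photon. -/
def phaseErrorEvent : Set (AliceRecord × BobRecord) :=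
  {z | z.1.basis = Z ∧ z.1.photons = 1 ∧ z.2.beta = some Z ∧ eX z.1 z.2 = .differ}

/-- Errors in the `X` basis with the label `ω`. -/
def errorEvent (ω : Intensity) : Set (AliceRecord × BobRecord) :=
  {z | z.1.basis = X ∧ z.1.inten = ω ∧ z.2.beta = some X ∧ eX z.1 z.2 = .differ}

/-- Cross-clicks with the label `ω`. -/
def crossEvent (ω : Intensity) : Set (AliceRecord × BobRecord) :=
  {z | z.1.inten = ω ∧ eX z.1 z.2 = .cross}

theorem differ_iff_Z (x : AliceRecord) (y : BobRecord) :
    (y.beta = some Z ∧ eX x y = .differ) ↔ (y.beta = some Z ∧ y.bitOn Z ≠ x.bit) := by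
  unfold BobRecord.beta eX
  rcases Bool.eq_false_or_eq_true (y.lineClicks Z) with hZ | hZ <;>
    rcases Bool.eq_false_or_eq_true (y.lineClicks X) with hX | hX <;> simp [hZ, hX]
  exact eq_comm.not

theorem differ_iff_X (x : AliceRecord) (y : BobRecord) :
    (y.beta = some X ∧ eX x y = .differ) ↔ (y.beta = some X ∧ y.bitOn X ≠ x.bit) := by
  unfold BobRecord.beta eX
  rcases Bool.eq_false_or_eq_true (y.lineClicks Z) with hZ | hZ <;>
    rcases Bool.eq_false_or_eq_true (y.lineClicks X) with hX | hX <;> simp [hZ, hX]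
  exact eq_comm.not

theorem cross_iff (x : AliceRecord) (y : BobRecord) :
    eX x y = .cross ↔ (y.lineClicks Z = true ∧ y.lineClicks X = true) := by
  unfold eX
  rcases Bool.eq_false_or_eq_true (y.lineClicks Z) with hZ | hZ <;>
    rcases Bool.eq_false_or_eq_true (y.lineClicks X) with hX | hX <;> simp [hZ, hX] <;>
    split_ifs <;> simp

/-- Weight of the records of one round, the records of the other rounds being fixed; the weight
`H α n s k` is that of the reception of the photon numbers `k`. -/
def roundWeight (P : Params) (H : BasisLabel → ℕ → Bool → ℕ × ℕ → ℝ≥0∞)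
    (z : AliceRecord × BobRecord) : ℝ≥0∞ :=
  ENNReal.ofReal (sourceWeight P z.1) *
    (H z.1.basis z.1.photons z.1.bit z.2.incoming * ENNReal.ofReal (bobProb P z.2))

/-- Expectation of `f` over the records of Bob. -/
def receptionSum (P : Params) (H : ℕ × ℕ → ℝ≥0∞) (f : BobRecord → ℝ) : ℝ≥0∞ :=
  ∑' y : BobRecord, H y.incoming * ENNReal.ofReal (bobProb P y * f y)

variable (P : Params) (H : BasisLabel → ℕ → Bool → ℕ × ℕ → ℝ≥0∞)

/-- Weight of an `X` basis error for a record of Alice. -/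
def errorYield (α : BasisLabel) (n : ℕ) (s : Bool) : ℝ≥0∞ :=
  if α = X then receptionSum P (H α n s) (differOn X s) else 0

/-- Weight of a cross-click for a record of Alice. -/
def crossYield (α : BasisLabel) (n : ℕ) (s : Bool) : ℝ≥0∞ :=
  receptionSum P (H α n s) crossInd

/-- Weight of a single-photon phase error for a record of Alice. -/
def phaseYield (α : BasisLabel) (n : ℕ) (s : Bool) : ℝ≥0∞ :=
  if α = Z ∧ n = 1 then receptionSum P (H α n s) (differOn Z s) else 0

theorem tsum_errorEvent (ω : Intensity) :
    ∑' z, (errorEvent ω).indicator (roundWeight P H) z = labelSum P (errorYield P H) ω := by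
  rw [labelSum]
  refine (ENNReal.tsum_prod (f := fun x y =>
    (errorEvent ω).indicator (roundWeight P H) (x, y))).trans (tsum_congr fun x => ?_)
  by_cases hω : x.inten = ω
  · by_cases hα : x.basis = X
    · rw [if_pos hω, errorYield, if_pos hα, receptionSum, ← ENNReal.tsum_mul_left]
      refine tsum_congr fun y => ?_
      have hiff : (x, y) ∈ errorEvent ω ↔ y.beta = some X ∧ y.bitOn X ≠ x.bit := by
        rw [← differ_iff_X]
        simp [errorEvent, hω, hα]
      by_cases h : y.beta = some X ∧ y.bitOn X ≠ x.bit
      · rw [Set.indicator_of_mem (hiff.2 h), differOn, if_pos h, mul_one, roundWeight]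
      · rw [Set.indicator_of_notMem (mt hiff.1 h), differOn, if_neg h]
        simp
    · rw [if_pos hω, errorYield, if_neg hα, mul_zero, ENNReal.tsum_eq_zero]
      exact fun y => Set.indicator_of_notMem (fun h => hα h.1) _
  · rw [if_neg hω, ENNReal.tsum_eq_zero]
    exact fun y => Set.indicator_of_notMem (fun h => hω h.2.1) _

theorem tsum_crossEvent (ω : Intensity) :
    ∑' z, (crossEvent ω).indicator (roundWeight P H) z = labelSum P (crossYield P H) ω := by
  rw [labelSum]
  refine (ENNReal.tsum_prod (f := fun x y =>
    (crossEvent ω).indicator (roundWeight P H) (x, y))).trans (tsum_congr fun x => ?_)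
  by_cases hω : x.inten = ω
  · rw [if_pos hω, crossYield, receptionSum, ← ENNReal.tsum_mul_left]
    refine tsum_congr fun y => ?_
    have hiff : (x, y) ∈ crossEvent ω ↔ y.lineClicks Z = true ∧ y.lineClicks X = true := by
      rw [← cross_iff x]
      simp [crossEvent, hω]
    by_cases h : y.lineClicks Z = true ∧ y.lineClicks X = true
    · rw [Set.indicator_of_mem (hiff.2 h), crossInd, if_pos h, mul_one, roundWeight]
    · rw [Set.indicator_of_notMem (mt hiff.1 h), crossInd, if_neg h]
      simp
  · rw [if_neg hω, ENNReal.tsum_eq_zero]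
    exact fun y => Set.indicator_of_notMem (fun h => hω h.1) _

theorem tsum_phaseErrorEvent :
    ∑' z, phaseErrorEvent.indicator (roundWeight P H) z = ∑ ω, labelSum P (phaseYield P H) ω := by
  simp only [labelSum]
  rw [← Summable.tsum_finsetSum fun _ _ => ENNReal.summable]
  refine (ENNReal.tsum_prod (f := fun x y =>
    phaseErrorEvent.indicator (roundWeight P H) (x, y))).trans (tsum_congr fun x => ?_)
  rw [Finset.sum_ite_eq, if_pos (Finset.mem_univ _)]
  by_cases hα : x.basis = Z ∧ x.photons = 1
  · rw [phaseYield, if_pos hα, receptionSum, ← ENNReal.tsum_mul_left]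
    refine tsum_congr fun y => ?_
    have hiff : (x, y) ∈ phaseErrorEvent ↔ y.beta = some Z ∧ y.bitOn Z ≠ x.bit := by
      rw [← differ_iff_Z]
      simp [phaseErrorEvent, hα]
    by_cases h : y.beta = some Z ∧ y.bitOn Z ≠ x.bit
    · rw [Set.indicator_of_mem (hiff.2 h), differOn, if_pos h, mul_one, roundWeight]
    · rw [Set.indicator_of_notMem (mt hiff.1 h), differOn, if_neg h]
      simp
  · rw [phaseYield, if_neg hα, mul_zero, ENNReal.tsum_eq_zero]
    exact fun y => Set.indicator_of_notMem (fun h => hα ⟨h.1, h.2.1⟩) _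

theorem pPhotonAvg_nonneg (n : ℕ) : 0 ≤ P.pPhotonAvg n :=
  Finset.sum_nonneg fun ω _ => mul_nonneg (P.pInten_pos ω).le (P.pPhoton_nonneg ω n)

theorem sum_labelSum_phaseYield :
    ∑ ω, labelSum P (phaseYield P H) ω =
      ENNReal.ofReal (P.pPhotonAvg 1) * yield P (phaseYield P H) 1 := by
  rw [Params.pPhotonAvg, ENNReal.ofReal_sum_of_nonneg fun ω _ =>
    mul_nonneg (P.pInten_pos ω).le (P.pPhoton_nonneg ω 1), Finset.sum_mul]
  refine Finset.sum_congr rfl fun ω _ => ?_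
  rw [labelSum_eq, tsum_eq_single 1, ENNReal.ofReal_mul (P.pInten_pos ω).le, mul_assoc]
  intro n hn
  have : yield P (phaseYield P H) n = 0 := by
    simp [yield, phaseYield, hn]
  rw [this, mul_zero]

variable (hH : ∀ s k, H Z 1 s k = H X 1 s k)
include hH

/-- The weights of single photons sent in the `Z` basis may be replaced by those of the `X` basis,
so `tsum_differOn_le` applies with one and the same H. Errors come from one basis with weight p_X,
which `c₁` divides out; cross-clicks come from both, with weights adding to 1. -/
theorem yield_phaseYield_le :
    yield P (phaseYield P H) 1 ≤ ENNReal.ofReal P.c₁ * yield P (errorYield P H) 1 +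
      ENNReal.ofReal P.c₂ * yield P (crossYield P H) 1 := by
  have hH' : ∀ s, H Z 1 s = H X 1 s := fun s => funext (hH s)
  have hZX : X ≠ Z := by simp
  have hsum : ENNReal.ofReal (P.pBasis Z) + ENNReal.ofReal (P.pBasis X) = 1 := by
    rw [← ENNReal.ofReal_add (P.pBasis_pos Z).le (P.pBasis_pos X).le, P.pBasis_sum,
      ENNReal.ofReal_one]
  have e1 : yield P (phaseYield P H) 1 =
      ∑ s, ENNReal.ofReal (P.pBasis Z) * receptionSum P (H X 1 s) (differOn Z s) := by
    simp [yield, phaseYield, hH']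
  have e2 : yield P (errorYield P H) 1 =
      ∑ s, ENNReal.ofReal (P.pBasis X) * receptionSum P (H X 1 s) (differOn X s) := by
    simp [yield, errorYield]
  have e3 : yield P (crossYield P H) 1 = ∑ s, receptionSum P (H X 1 s) crossInd := by
    rw [yield, sum_basisLabel, ← Finset.sum_add_distrib]
    refine Finset.sum_congr rfl fun s _ => ?_
    rw [crossYield, crossYield, hH', ← add_mul, hsum, one_mul]
  rw [e1, e2, e3, Finset.mul_sum, Finset.mul_sum, ← Finset.sum_add_distrib]
  exact Finset.sum_le_sum fun s _ => tsum_differOn_le P s (H X 1 s)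

/-- The bound on single-photon phase errors by the decoy-state method in one round. -/
theorem roundWeight_le :
    ∑' z, phaseErrorEvent.indicator (roundWeight P H) z +
      ENNReal.ofReal (P.pPhotonAvg 1 / P.mu D) * (ENNReal.ofReal (1 / P.pInten V) *
        (ENNReal.ofReal P.c₁ * ∑' z, (errorEvent V).indicator (roundWeight P H) z +
          ENNReal.ofReal P.c₂ * ∑' z, (crossEvent V).indicator (roundWeight P H) z)) ≤
      ENNReal.ofReal (P.pPhotonAvg 1 / P.mu D) *
        (ENNReal.ofReal (Real.exp (P.mu D) / P.pInten D) *
        (ENNReal.ofReal P.c₁ * ∑' z, (errorEvent D).indicator (roundWeight P H) z +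
          ENNReal.ofReal P.c₂ * ∑' z, (crossEvent D).indicator (roundWeight P H) z)) := by
  rw [tsum_phaseErrorEvent, tsum_errorEvent, tsum_errorEvent, tsum_crossEvent, tsum_crossEvent,
    sum_labelSum_phaseYield]
  have hmu := P.mu_D_pos
  have hK : ENNReal.ofReal (P.pPhotonAvg 1) =
      ENNReal.ofReal (P.pPhotonAvg 1 / P.mu D) * ENNReal.ofReal (P.mu D) := by
    rw [← ENNReal.ofReal_mul (div_nonneg (pPhotonAvg_nonneg P 1) hmu.le),
      div_mul_cancel₀ _ hmu.ne']
  rw [hK]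
  have h1 := decoy_le P (errorYield P H)
  have h2 := decoy_le P (crossYield P H)
  have h3 := yield_phaseYield_le P H hH
  generalize ENNReal.ofReal (P.pPhotonAvg 1 / P.mu D) = K
  calc _ ≤ K * ENNReal.ofReal (P.mu D) * (ENNReal.ofReal P.c₁ * yield P (errorYield P H) 1 +
          ENNReal.ofReal P.c₂ * yield P (crossYield P H) 1) + _ := by gcongr
    _ = K * (ENNReal.ofReal P.c₁ * (ENNReal.ofReal (1 / P.pInten V) *
            labelSum P (errorYield P H) V + ENNReal.ofReal (P.mu D) * yield P (errorYield P H) 1) +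
          ENNReal.ofReal P.c₂ * (ENNReal.ofReal (1 / P.pInten V) *
            labelSum P (crossYield P H) V +
            ENNReal.ofReal (P.mu D) * yield P (crossYield P H) 1)) := by ring
    _ ≤ K * (ENNReal.ofReal P.c₁ * (ENNReal.ofReal (Real.exp (P.mu D) / P.pInten D) *
            labelSum P (errorYield P H) D) +
          ENNReal.ofReal P.c₂ * (ENNReal.ofReal (Real.exp (P.mu D) / P.pInten D) *
            labelSum P (crossYield P H) D)) := by gcongr
    _ = _ := by ring

end decoy

/-! ### The law of a round given the other rounds -/

section rounds

/-- Amplitude of the emitted pulse without the probabilities of label, photon number and basis. -/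
def emitShape (α : BasisLabel) (n : ℕ) (s : Bool) (k : ℕ × ℕ) : ℝ :=
  ∑ a : Bool, bitOverlap α s a * √(1 / 2) * numberAmp (polarization α a) n k

theorem emitAmp_eq (P : Params) (r : AliceRecord) (k : ℕ × ℕ) :
    emitAmp P r k = √(sourceWeight P r) * emitShape r.basis r.photons r.bit k := by
  rw [emitAmp, emitShape, Finset.mul_sum]
  refine Finset.sum_congr rfl fun a _ => ?_
  rw [← sourceWeight, div_eq_mul_one_div, Real.sqrt_mul (sourceWeight_nonneg P r)]
  ring

/-- Single-photon pulses carry no information on the basis. -/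
theorem emitShape_one (s : Bool) : emitShape Z 1 s = emitShape X 1 s := by
  funext k
  obtain ⟨k1, k2⟩ := k
  have h2 : √(2 : ℝ) ≠ 0 := by positivity
  by_cases hk : k1 + k2 = 1
  -- In both bases the amplitudes are 1/2 at (1, 0) and ±1/2 at (0, 1), with the minus sign if s is
  -- true: the complementary outcome for horizontal and vertical prepares a diagonal or
  -- anti-diagonal photon.
  · obtain ⟨rfl, rfl⟩ | ⟨rfl, rfl⟩ : (k1 = 0 ∧ k2 = 1) ∨ (k1 = 1 ∧ k2 = 0) := by omega
    all_goals cases s <;> simp [emitShape, bitOverlap, numberAmp, polarization]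
  · simp [emitShape, numberAmp, hk]

variable {N : ℕ}

/-- The product state with photon numbers `n` and amplitudes `amp`. -/
def productState (n : Fin N → ℕ) (amp : Fin N → ℕ × ℕ → ℝ) : Pulses N ℂ :=
  ∑ k ∈ Fintype.piFinset (fun i => Finset.HasAntidiagonal.antidiagonal (n i)),
    lp.single 2 k (((∏ i, amp i (k i) : ℝ)) : ℂ)

theorem productState_smul (n : Fin N → ℕ) (amp amp' : Fin N → ℕ × ℕ → ℝ) (i : Fin N) (c : ℝ)
    (h : ∀ k, amp i k = c * amp' i k) (h' : ∀ j, j ≠ i → amp j = amp' j) :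
    productState n amp = (c : ℂ) • productState n amp' := by
  rw [productState, productState, Finset.smul_sum]
  refine Finset.sum_congr rfl fun k _ => ?_
  rw [← lp.single_smul]
  congr 1
  rw [smul_eq_mul, ← Complex.ofReal_mul]
  congr 1
  rw [← Finset.mul_prod_erase _ _ (Finset.mem_univ i),
    ← Finset.mul_prod_erase _ _ (Finset.mem_univ i), h, mul_assoc]
  congr 2
  exact Finset.prod_congr rfl fun j hj => by rw [h' j (Finset.ne_of_mem_erase hj)]

/-- The records of all rounds but the `i`-th. -/
abbrev OtherRounds (i : Fin N) := ({j // j ≠ i} → AliceRecord) × ({j // j ≠ i} → BobRecord)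

/-- A run as the records of the `i`-th round and of the other rounds. -/
def runSplit (i : Fin N) : OtherRounds i × (AliceRecord × BobRecord) ≃ Run N where
  toFun t := ((Equiv.funSplitAt i _).symm (t.2.1, t.1.1), (Equiv.funSplitAt i _).symm (t.2.2, t.1.2))
  invFun r := (((Equiv.funSplitAt i _ r.1).2, (Equiv.funSplitAt i _ r.2).2), (r.1 i, r.2 i))
  left_inv t := by
    obtain ⟨⟨cx, cy⟩, x, y⟩ := t
    simp [Equiv.funSplitAt]
  right_inv r := by
    refine Prod.ext ?_ ?_
    · exact (Equiv.funSplitAt i _).symm_apply_apply r.1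
    · exact (Equiv.funSplitAt i _).symm_apply_apply r.2

theorem runSplit_fst_self (i : Fin N) (c : OtherRounds i) (z : AliceRecord × BobRecord) :
    (runSplit i (c, z)).1 i = z.1 := by
  simp [runSplit]

theorem runSplit_snd_self (i : Fin N) (c : OtherRounds i) (z : AliceRecord × BobRecord) :
    (runSplit i (c, z)).2 i = z.2 := by
  simp [runSplit]

theorem runSplit_fst_of_ne {i j : Fin N} (h : j ≠ i) (c : OtherRounds i)
    (z : AliceRecord × BobRecord) : (runSplit i (c, z)).1 j = c.1 ⟨j, h⟩ := by
  simp [runSplit, h]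

theorem runSplit_snd_of_ne {i j : Fin N} (h : j ≠ i) (c : OtherRounds i)
    (z : AliceRecord × BobRecord) : (runSplit i (c, z)).2 j = c.2 ⟨j, h⟩ := by
  simp [runSplit, h]

variable {K : Type*} [NormedAddCommGroup K] [InnerProductSpace ℂ K]

/-- Weight of the photon numbers `k` received in the `i`-th round for a record `(α, n, s)` of Alice,
the records of the other rounds being fixed. -/
def receptionWeight (P : Params) (V : Attack N K) (i : Fin N) (c : OtherRounds i)
    (α : BasisLabel) (n : ℕ) (s : Bool) (k : ℕ × ℕ) : ℝ≥0∞ :=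
  ENNReal.ofReal (‖(V (productState ((Equiv.funSplitAt i _).symm (n, fun j => (c.1 j).photons))
      ((Equiv.funSplitAt i _).symm (emitShape α n s, fun j => emitAmp P (c.1 j)))) :
      (Fin N → ℕ × ℕ) → K) ((Equiv.funSplitAt i _).symm (k, fun j => (c.2 j).incoming))‖ ^ 2 *
    ∏ j, bobProb P (c.2 j))

theorem runProb_eq (P : Params) (V : Attack N K) (r : Run N) :
    runProb P V r = ‖(V (emitted P r.1) : (Fin N → ℕ × ℕ) → K) (fun i => (r.2 i).incoming)‖ ^ 2 *
      ∏ i, bobProb P (r.2 i) := by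
  simp only [runProb, finalState, bobProb, norm_smul, mul_pow, Complex.norm_real,
    Real.norm_eq_abs, sq_abs, Finset.prod_mul_distrib, Finset.prod_pow]
  ring

/-- The attack is linear, so √(`sourceWeight`) of round i comes out of its state. The label of that
round occurs in this scalar only; `receptionWeight` therefore depends on basis, photon number and
bit but not on the intensity, although the attack acts jointly on all rounds. -/
theorem runProb_runSplit (P : Params) (V : Attack N K) (i : Fin N) (c : OtherRounds i)
    (z : AliceRecord × BobRecord) :
    ENNReal.ofReal (runProb P V (runSplit i (c, z))) =
      roundWeight P (receptionWeight P V i c) z := by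
  have hinc : (fun j => ((runSplit i (c, z)).2 j).incoming) =
      (Equiv.funSplitAt i _).symm (z.2.incoming, fun j => (c.2 j).incoming) := by
    funext j
    by_cases h : j = i
    · subst h; simp [runSplit]
    · simp [runSplit, h]
  have hem : emitted P (runSplit i (c, z)).1 = ((√(sourceWeight P z.1) : ℝ) : ℂ) •
      productState ((Equiv.funSplitAt i _).symm (z.1.photons, fun j => (c.1 j).photons))
        ((Equiv.funSplitAt i _).symm (emitShape z.1.basis z.1.photons z.1.bit,
          fun j => emitAmp P (c.1 j))) := by
    have hn : (fun j => ((runSplit i (c, z)).1 j).photons) =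
        (Equiv.funSplitAt i _).symm (z.1.photons, fun j => (c.1 j).photons) := by
      funext j
      by_cases h : j = i
      · subst h; simp [runSplit]
      · simp [runSplit, h]
    rw [← hn]
    refine productState_smul _ (fun j => emitAmp P ((runSplit i (c, z)).1 j)) _ i _ ?_ ?_
    · intro k
      simp only [runSplit_fst_self, emitAmp_eq]
      simp
    · intro j h
      simp [runSplit, h]
  have hprod : ∏ j, bobProb P ((runSplit i (c, z)).2 j) =
      bobProb P z.2 * ∏ j, bobProb P (c.2 j) := by
    rw [Fintype.prod_eq_mul_prod_subtype_ne _ i, runSplit_snd_self]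
    congr 1
    exact Finset.prod_congr rfl fun j _ => by rw [runSplit_snd_of_ne j.2]
  rw [runProb_eq, hinc, hem, hprod, map_smul, roundWeight, receptionWeight, lp.coeFn_smul,
    Pi.smul_apply, norm_smul, mul_pow, Complex.norm_real, Real.norm_eq_abs, sq_abs,
    Real.sq_sqrt (sourceWeight_nonneg P z.1),
    ← ENNReal.ofReal_mul (mul_nonneg (sq_nonneg _)
      (Finset.prod_nonneg fun j _ => bobProb_nonneg P _)),
    ← ENNReal.ofReal_mul (sourceWeight_nonneg P z.1)]
  congr 1
  ring

/-- The event that the records of the `i`-th round are in `E`. -/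
def roundEvent (i : Fin N) (E : Set (AliceRecord × BobRecord)) : Set (Run N) :=
  {r | (r.1 i, r.2 i) ∈ E}

/-- The event `A` does not depend on the records of the `i`-th round. -/
def IndependentOfRound (i : Fin N) (A : Set (Run N)) : Prop :=
  ∀ c z z', runSplit i (c, z) ∈ A → runSplit i (c, z') ∈ A

-- The records c comprise the rounds before and after i. As A does not look at round i, its
-- indicator is a function of c and comes out of the sum over that round.
open Classical in
theorem law_inter_roundEvent (P : Params) (V : Attack N K) {i : Fin N} {A : Set (Run N)}
    (hA : IndependentOfRound i A) (E : Set (AliceRecord × BobRecord)) :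
    (law P V).toOuterMeasure (A ∩ roundEvent i E) =
      ∑' c : OtherRounds i, (if ∃ z, runSplit i (c, z) ∈ A then 1 else 0) *
        ∑' z, E.indicator (roundWeight P (receptionWeight P V i c)) z := by
  rw [PMF.toOuterMeasure_apply, ← (runSplit i).tsum_eq]
  refine (ENNReal.tsum_prod (f := fun c z => (A ∩ roundEvent i E).indicator
    (law P V) (runSplit i (c, z)))).trans (tsum_congr fun c => ?_)
  have hmem : ∀ z, runSplit i (c, z) ∈ roundEvent i E ↔ z ∈ E := fun z => by
    change ((runSplit i (c, z)).1 i, (runSplit i (c, z)).2 i) ∈ E ↔ _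
    rw [runSplit_fst_self, runSplit_snd_self]
  split_ifs with h
  · obtain ⟨z₀, hz₀⟩ := h
    rw [one_mul]
    refine tsum_congr fun z => ?_
    by_cases hz : z ∈ E
    · have hz' : runSplit i (c, z) ∈ A ∩ roundEvent i E := ⟨hA c _ z hz₀, (hmem z).2 hz⟩
      rw [Set.indicator_of_mem hz', Set.indicator_of_mem hz, ← runProb_runSplit]
      rfl
    · rw [Set.indicator_of_notMem fun h' => hz ((hmem z).1 h'.2), Set.indicator_of_notMem hz]
  · rw [zero_mul, ENNReal.tsum_eq_zero]
    exact fun z => Set.indicator_of_notMem (fun h' => h ⟨z, h'.1⟩) _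

theorem receptionWeight_one (P : Params) (V : Attack N K) (i : Fin N) (c : OtherRounds i)
    (s : Bool) (k : ℕ × ℕ) : receptionWeight P V i c Z 1 s k = receptionWeight P V i c X 1 s k := by
  rw [receptionWeight, receptionWeight, emitShape_one]

/-- The bound on single-photon phase errors by the decoy-state method, on an event that does not
depend on the round. -/
theorem law_inter_phaseErrorEvent_le (P : Params) (V : Attack N K) {i : Fin N} {A : Set (Run N)}
    (hA : IndependentOfRound i A) :
    (law P V).toOuterMeasure (A ∩ roundEvent i phaseErrorEvent) +
      ENNReal.ofReal (P.pPhotonAvg 1 / P.mu D) * (ENNReal.ofReal (1 / P.pInten .V) *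
        (ENNReal.ofReal P.c₁ * (law P V).toOuterMeasure (A ∩ roundEvent i (errorEvent .V)) +
          ENNReal.ofReal P.c₂ *
            (law P V).toOuterMeasure (A ∩ roundEvent i (crossEvent .V)))) ≤
      ENNReal.ofReal (P.pPhotonAvg 1 / P.mu D) *
        (ENNReal.ofReal (Real.exp (P.mu D) / P.pInten D) *
        (ENNReal.ofReal P.c₁ * (law P V).toOuterMeasure (A ∩ roundEvent i (errorEvent D)) +
          ENNReal.ofReal P.c₂ *
            (law P V).toOuterMeasure (A ∩ roundEvent i (crossEvent D)))) := by
  classical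
  -- The inner sums are given a name so that constants are moved only into the sum over c.
  obtain ⟨T, hT⟩ : ∃ T : OtherRounds i → Set (AliceRecord × BobRecord) → ℝ≥0∞, ∀ c E,
      ∑' z, E.indicator (roundWeight P (receptionWeight P V i c)) z = T c E :=
    ⟨_, fun _ _ => rfl⟩
  simp only [law_inter_roundEvent P V hA, hT]
  simp only [← ENNReal.tsum_mul_left, ← ENNReal.tsum_add]
  refine ENNReal.tsum_le_tsum fun c => ?_
  have h := roundWeight_le P (receptionWeight P V i c) (receptionWeight_one P V i c)
  simp only [hT] at h
  generalize (if ∃ z, runSplit i (c, z) ∈ A then (1 : ℝ≥0∞) else 0) = t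
  refine le_trans (le_of_eq ?_) ((mul_le_mul_right h t).trans (le_of_eq ?_)) <;> ring

end rounds

/-! ### The bound -/

section bound

open MeasureTheory

variable {N : ℕ}

instance runMeasurableSpace : MeasurableSpace (Run N) := ⊤

/-- The records of the first `n` rounds generate the `n`-th σ-algebra. -/
def runFiltration (N : ℕ) : Filtration ℕ (runMeasurableSpace (N := N)) where
  seq n :=
    { MeasurableSet' := fun A => ∀ r r' : Run N,
        (∀ j : Fin N, j.val < n → r.1 j = r'.1 j ∧ r.2 j = r'.2 j) → r ∈ A → r' ∈ A
      measurableSet_empty := fun _ _ _ h => h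
      measurableSet_compl := fun _ hA r r' h hr hr' =>
        hr (hA r' r (fun j hj => ⟨(h j hj).1.symm, (h j hj).2.symm⟩) hr')
      measurableSet_iUnion := fun f hf r r' h hr => by
        obtain ⟨k, hk⟩ := Set.mem_iUnion.1 hr
        exact Set.mem_iUnion.2 ⟨k, hf k r r' h hk⟩ }
  mono' m n hmn A hA r r' h := hA r r' fun j hj => h j (hj.trans_le hmn)
  le' _ _ _ := trivial

/-- Rounds are numbered from 0, so the σ-algebra with index i knows the rounds before i and not
round i itself. -/
theorem independentOfRound_of_measurableSet {i : Fin N} {A : Set (Run N)}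
    (hA : MeasurableSet[runFiltration N i.val] A) : IndependentOfRound i A := by
  intro c z z' h
  refine hA _ _ (fun j hj => ?_) h
  have hne : j ≠ i := fun h => by subst h; exact lt_irrefl _ hj
  exact ⟨by rw [runSplit_fst_of_ne hne, runSplit_fst_of_ne hne],
    by rw [runSplit_snd_of_ne hne, runSplit_snd_of_ne hne]⟩

/-- The event that the `n`-th round exists and its records are in `E`. -/
def seqEvent (N : ℕ) (E : Set (AliceRecord × BobRecord)) (n : ℕ) : Set (Run N) :=
  {r | ∃ h : n < N, (r.1 ⟨n, h⟩, r.2 ⟨n, h⟩) ∈ E}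

theorem seqEvent_val (E : Set (AliceRecord × BobRecord)) (i : Fin N) :
    seqEvent N E i.val = roundEvent i E := by
  ext r
  exact ⟨fun ⟨_, h⟩ => h, fun h => ⟨i.2, h⟩⟩

theorem measurableSet_seqEvent (E : Set (AliceRecord × BobRecord)) (n : ℕ) :
    MeasurableSet[runFiltration N (n + 1)] (seqEvent N E n) := by
  rintro r r' h ⟨hn, hE⟩
  obtain ⟨h1, h2⟩ := h ⟨n, hn⟩ (Nat.lt_succ_self n)
  exact ⟨hn, by rw [← h1, ← h2]; exact hE⟩

theorem countOf_seqEvent (E : Set (AliceRecord × BobRecord)) (r : Run N) {p : Fin N → Prop}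
    [DecidablePred p] (hp : ∀ i, p i ↔ (r.1 i, r.2 i) ∈ E) :
    countOf (seqEvent N E) N r = ((Finset.univ.filter p).card : ℝ) := by
  rw [countOf, ← Fin.sum_univ_eq_sum_range
    (fun n => (seqEvent N E n).indicator (fun _ => (1 : ℝ)) r), Finset.card_filter, Nat.cast_sum]
  refine Finset.sum_congr rfl fun i _ => ?_
  rw [seqEvent_val]
  by_cases h : p i
  · rw [Set.indicator_of_mem (show r ∈ roundEvent i E from (hp i).1 h), if_pos h, Nat.cast_one]
  · rw [Set.indicator_of_notMem (show r ∉ roundEvent i E from mt (hp i).2 h), if_neg h,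
      Nat.cast_zero]

theorem countOf_phaseErrorEvent (r : Run N) :
    countOf (seqEvent N phaseErrorEvent) N r = (numPh 1 r : ℝ) :=
  countOf_seqEvent _ r fun _ => Iff.rfl

theorem countOf_errorEvent (r : Run N) (ω : Intensity) :
    countOf (seqEvent N (errorEvent ω)) N r = (numErrorX r ω : ℝ) :=
  countOf_seqEvent _ r fun _ => Iff.rfl

theorem countOf_crossEvent (r : Run N) (ω : Intensity) :
    countOf (seqEvent N (crossEvent ω)) N r = (numCross r ω : ℝ) :=
  countOf_seqEvent _ r fun _ => Iff.rfl

/-! ### From past events to conditional probabilities. -/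

/-- A function with nonnegative integrals over the sets of a sub-σ-algebra has a nonnegative
conditional expectation. -/
theorem condExp_nonneg_of_forall_setIntegral_nonneg {Ω : Type*} {m m0 : MeasurableSpace Ω}
    (hm : m ≤ m0) (μ : Measure Ω) [IsFiniteMeasure μ] {g : Ω → ℝ} (hg : Integrable g μ)
    (h : ∀ s, MeasurableSet[m] s → 0 ≤ ∫ ω in s, g ω ∂μ) : 0 ≤ᵐ[μ] μ[g | m] := by
  refine ae_le_of_ae_le_trim (hm := hm) ?_
  refine ae_nonneg_of_forall_setIntegral_nonneg
    (integrable_condExp.trim hm stronglyMeasurable_condExp) fun s hs _ => ?_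
  rw [← setIntegral_trim hm stronglyMeasurable_condExp hs, setIntegral_condExp hm hg hs]
  exact h s hs

variable {K : Type*} [NormedAddCommGroup K] [InnerProductSpace ℂ K]

/-- The law of the virtual protocol as a measure. -/
def runMeasure (P : Params) (V : Attack N K) : Measure (Run N) := (law P V).toMeasure

instance (P : Params) (V : Attack N K) : IsProbabilityMeasure (runMeasure P V) :=
  inferInstanceAs (IsProbabilityMeasure (law P V).toMeasure)

theorem runMeasure_apply (P : Params) (V : Attack N K) (s : Set (Run N)) :
    runMeasure P V s = (law P V).toOuterMeasure s :=
  PMF.toMeasure_apply_eq_toOuterMeasure_apply _ trivial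

/-- The decoy-state combination of the quantities `f`. -/
def decoyComb (P : Params) (f : Set (AliceRecord × BobRecord) → ℝ) : ℝ :=
  P.pPhotonAvg 1 / P.mu D * (
    P.c₁ * (Real.exp (P.mu D) / P.pInten D * f (errorEvent D) -
      1 / P.pInten V * f (errorEvent V)) +
    P.c₂ * (Real.exp (P.mu D) / P.pInten D * f (crossEvent D) -
      1 / P.pInten V * f (crossEvent V)))

theorem measureReal_phaseErrorEvent_le (P : Params) (V : Attack N K) {i : Fin N} {s : Set (Run N)}
    (hs : MeasurableSet[runFiltration N i.val] s) :
    (runMeasure P V).real (s ∩ seqEvent N phaseErrorEvent i.val) ≤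
      decoyComb P fun E => (runMeasure P V).real (s ∩ seqEvent N E i.val) := by
  have h := law_inter_phaseErrorEvent_le P V (independentOfRound_of_measurableSet hs)
  have hp : 0 ≤ P.pPhotonAvg 1 / P.mu D := div_nonneg (pPhotonAvg_nonneg P 1) P.mu_D_pos.le
  have hD := P.pInten_pos D
  have hV := P.pInten_pos .V
  have h1 := P.c₁_nonneg
  have h2 := P.c₂_nonneg
  simp only [seqEvent_val]
  have hreal : ∀ A, (law P V).toOuterMeasure A = ENNReal.ofReal ((runMeasure P V).real A) :=
    fun A => by rw [ofReal_measureReal, runMeasure_apply]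
  rw [hreal, hreal, hreal, hreal, hreal, ← ENNReal.ofReal_mul (by positivity), ← ENNReal.ofReal_mul (by positivity),
    ← ENNReal.ofReal_mul (by positivity), ← ENNReal.ofReal_mul (by positivity),
    ← ENNReal.ofReal_add (by positivity) (by positivity),
    ← ENNReal.ofReal_add (by positivity) (by positivity),
    ← ENNReal.ofReal_mul (by positivity), ← ENNReal.ofReal_mul (by positivity),
    ← ENNReal.ofReal_mul (by positivity), ← ENNReal.ofReal_mul (by positivity),
    ← ENNReal.ofReal_add (by positivity) (by positivity),
    ENNReal.ofReal_le_ofReal_iff (by positivity)] at h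
  unfold decoyComb
  linarith

/-- The one-round inequality holds on every event of the past. The difference g of its two sides
thus has nonnegative integral over each such event, so its conditional expectation is nonnegative,
and linearity separates it into conditional probabilities. -/
theorem condProb_phaseErrorEvent_le (P : Params) (V : Attack N K) (i : Fin N) :
    ∀ᵐ r ∂(runMeasure P V),
      condProb (runMeasure P V) (runFiltration N) (seqEvent N phaseErrorEvent) i.val r ≤
        decoyComb P fun E =>
          condProb (runMeasure P V) (runFiltration N) (seqEvent N E) i.val r := by
  let μ := runMeasure P V
  let I : Set (AliceRecord × BobRecord) → Run N → ℝ := fun E =>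
    (seqEvent N E i.val).indicator (fun _ => (1 : ℝ))
  have hI : ∀ E, Integrable (I E) μ := fun E => integrable_indicator_one μ trivial
  let k := P.pPhotonAvg 1 / P.mu D
  let u := Real.exp (P.mu D) / P.pInten D
  let v := 1 / P.pInten .V
  let g : Run N → ℝ := (k * P.c₁ * u) • I (errorEvent D) - (k * P.c₁ * v) • I (errorEvent .V) +
    ((k * P.c₂ * u) • I (crossEvent D) - (k * P.c₂ * v) • I (crossEvent .V)) - I phaseErrorEvent
  have hi1 := (hI (errorEvent D)).smul (k * P.c₁ * u)
  have hi2 := (hI (errorEvent .V)).smul (k * P.c₁ * v)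
  have hi3 := (hI (crossEvent D)).smul (k * P.c₂ * u)
  have hi4 := (hI (crossEvent .V)).smul (k * P.c₂ * v)
  have hg : Integrable g μ := (((hi1.sub hi2).add (hi3.sub hi4)).sub (hI _))
  have hnn : 0 ≤ᵐ[μ] μ[g | runFiltration N i.val] := by
    refine condExp_nonneg_of_forall_setIntegral_nonneg ((runFiltration N).le _) μ hg
      fun s hs => ?_
    have hint : ∀ E, ∫ r in s, I E r ∂μ = μ.real (s ∩ seqEvent N E i.val) := by
      intro E
      have h : MeasurableSet (seqEvent N E i.val) := trivial
      rw [integral_indicator h, Measure.restrict_restrict h, setIntegral_const, Set.inter_comm]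
      simp
    have h := measureReal_phaseErrorEvent_le P V hs
    have e : ∫ r in s, g r ∂μ = k * P.c₁ * u * ∫ r in s, I (errorEvent D) r ∂μ -
        k * P.c₁ * v * ∫ r in s, I (errorEvent .V) r ∂μ +
        (k * P.c₂ * u * ∫ r in s, I (crossEvent D) r ∂μ -
          k * P.c₂ * v * ∫ r in s, I (crossEvent .V) r ∂μ) -
        ∫ r in s, I phaseErrorEvent r ∂μ := by
      simp only [g]
      rw [integral_sub' ((hi1.sub hi2).add (hi3.sub hi4)).integrableOn (hI _).integrableOn,
        integral_add' (hi1.sub hi2).integrableOn (hi3.sub hi4).integrableOn,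
        integral_sub' hi1.integrableOn hi2.integrableOn,
        integral_sub' hi3.integrableOn hi4.integrableOn]
      simp only [Pi.smul_apply, smul_eq_mul, integral_const_mul]
    rw [e]
    simp only [hint]
    unfold decoyComb at h
    simp only [k, u, v]
    linarith
  filter_upwards [hnn,
    condExp_sub ((hi1.sub hi2).add (hi3.sub hi4)) (hI phaseErrorEvent) (runFiltration N i.val),
    condExp_add (hi1.sub hi2) (hi3.sub hi4) (runFiltration N i.val),
    condExp_sub hi1 hi2 (runFiltration N i.val), condExp_sub hi3 hi4 (runFiltration N i.val),
    condExp_smul (μ := μ) (k * P.c₁ * u) (I (errorEvent D)) (runFiltration N i.val),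
    condExp_smul (μ := μ) (k * P.c₁ * v) (I (errorEvent .V)) (runFiltration N i.val),
    condExp_smul (μ := μ) (k * P.c₂ * u) (I (crossEvent D)) (runFiltration N i.val),
    condExp_smul (μ := μ) (k * P.c₂ * v) (I (crossEvent .V)) (runFiltration N i.val)]
    with r h0 h1 h2 h3 h4 h5 h6 h7 h8
  simp only [Pi.sub_apply, Pi.add_apply, Pi.smul_apply, smul_eq_mul] at h1 h2 h3 h4 h5 h6 h7 h8
  change 0 ≤ _ at h0
  simp only [g] at h0
  rw [h1, h2, h3, h4, h5, h6, h7, h8] at h0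
  unfold decoyComb condProb
  simp only [k, u, v, I, μ] at h0
  linarith

theorem decoyComb_sum (P : Params) {ι : Type*} (t : Finset ι)
    (f : ι → Set (AliceRecord × BobRecord) → ℝ) :
    ∑ i ∈ t, decoyComb P (f i) = decoyComb P fun E => ∑ i ∈ t, f i E := by
  simp only [decoyComb, Finset.mul_sum, ← Finset.sum_sub_distrib, ← Finset.sum_add_distrib]

theorem sum_condProb_phaseErrorEvent_le (P : Params) (V : Attack N K) :
    ∀ᵐ r ∂(runMeasure P V), ∑ n ∈ Finset.range N,
      condProb (runMeasure P V) (runFiltration N) (seqEvent N phaseErrorEvent) n r ≤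
        decoyComb P fun E => ∑ n ∈ Finset.range N,
          condProb (runMeasure P V) (runFiltration N) (seqEvent N E) n r := by
  filter_upwards [ae_all_iff.2 (condProb_phaseErrorEvent_le P V)] with r h
  rw [← decoyComb_sum]
  exact Finset.sum_le_sum fun n hn => h ⟨n, Finset.mem_range.1 hn⟩

theorem numPh_le (n : ℕ) (r : Run N) : numPh n r ≤ N :=
  (Finset.card_filter_le _ _).trans (by simp)

/-- The bound follows from the five bounds on sums of conditional probabilities. -/
theorem numPh_le_nPhUpper (P : Params) (hN : 0 < N) {ε estPh : ℝ} {estErr estCross : Intensity → ℝ}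
    {r : Run N} {f : Set (AliceRecord × BobRecord) → ℝ}
    (hf : f phaseErrorEvent ≤ decoyComb P f)
    (hph : (numPh 1 r : ℝ) - deltaL (numPh 1 r) estPh N ε ≤ f phaseErrorEvent)
    (hED : f (errorEvent D) ≤ numErrorX r D + deltaU (numErrorX r D) (estErr D) N ε)
    (hEV : numErrorX r V - deltaL (numErrorX r V) (estErr V) N ε ≤ f (errorEvent V))
    (hCD : f (crossEvent D) ≤ numCross r D + deltaU (numCross r D) (estCross D) N ε)
    (hCV : numCross r V - deltaL (numCross r V) (estCross V) N ε ≤ f (crossEvent V)) :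
    (numPh 1 r : ℝ) ≤ nPhUpper P N ε estPh estErr estCross (numErrorX r) (numCross r) := by
  unfold nPhUpper
  split_ifs with ha
  swap
  · exact_mod_cast numPh_le 1 r
  have hN' : (0 : ℝ) < N := Nat.cast_pos.2 hN
  have hs : 0 < √(N : ℝ) := Real.sqrt_pos.2 hN'
  have hD := P.pInten_pos D
  have hV := P.pInten_pos V
  have hp : 0 ≤ P.pPhotonAvg 1 / P.mu D := div_nonneg (pPhotonAvg_nonneg P 1) P.mu_D_pos.le
  have hpos : 0 < 1 - 2 * aL N estPh ε / √(N : ℝ) := by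
    rw [sub_pos, div_lt_one hs]
    linarith
  -- The label `D` enters with a plus sign and `V` with a minus sign, so the former needs an upper
  -- and the latter a lower deviation bound.
  have hterm : ∀ {xD xV mD mV : ℝ}, xD ≤ mD → mV ≤ xV →
      Real.exp (P.mu D) / P.pInten D * xD - 1 / P.pInten V * xV ≤
        Real.exp (P.mu D) * mD / P.pInten D - mV / P.pInten V := by
    intro xD xV mD mV h1 h2
    have h3 := mul_le_mul_of_nonneg_left h1 (by positivity : 0 ≤ Real.exp (P.mu D) / P.pInten D)
    have h4 := mul_le_mul_of_nonneg_left h2 (by positivity : 0 ≤ 1 / P.pInten V)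
    have e1 : Real.exp (P.mu D) * mD / P.pInten D = Real.exp (P.mu D) / P.pInten D * mD := by ring
    have e2 : mV / P.pInten V = 1 / P.pInten V * mV := by ring
    rw [e1, e2]
    linarith
  have hcomb : decoyComb P f ≤ P.pPhotonAvg 1 / P.mu D *
      (P.c₁ * decoyTerm P N ε estErr (numErrorX r) +
        P.c₂ * decoyTerm P N ε estCross (numCross r)) :=
    mul_le_mul_of_nonneg_left (add_le_add
      (mul_le_mul_of_nonneg_left (hterm hED hEV) P.c₁_nonneg)
      (mul_le_mul_of_nonneg_left (hterm hCD hCV) P.c₂_nonneg)) hp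
  rw [inv_mul_eq_div, le_div_iff₀ hpos]
  -- `deltaL` is affine in the count with slope 2a/√N, so the inequality can be solved for the
  -- count; the coefficient 1 - 2a/√N is positive exactly in the nontrivial case.
  have e : (numPh 1 r : ℝ) * (1 - 2 * aL N estPh ε / √(N : ℝ)) =
      numPh 1 r - deltaL (numPh 1 r) estPh N ε + (bL N estPh ε - aL N estPh ε) * √(N : ℝ) := by
    have hss := Real.mul_self_sqrt hN'.le
    unfold deltaL
    generalize bL N estPh ε = b at *
    generalize aL N estPh ε = a at *
    generalize √(N : ℝ) = s at *
    rw [← hss]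
    field_simp
    ring
  rw [e]
  linarith

theorem nPhUpper_failure_le (P : Params) (hN : 0 < N) (V : Attack N K) {ε : ℝ} (h0 : 0 < ε)
    (h1 : ε < 1) (estPh : ℝ) (estErr estCross : Intensity → ℝ) :
    (law P V).toOuterMeasure {r | nPhUpper P N ε estPh estErr estCross (numErrorX r) (numCross r) <
      (numPh 1 r : ℝ)} ≤ ENNReal.ofReal (5 * ε) := by
  let μ := runMeasure P V
  let S : Set (AliceRecord × BobRecord) → Run N → ℝ := fun E r =>
    ∑ n ∈ Finset.range N, condProb μ (runFiltration N) (seqEvent N E) n r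
  have hU := fun E => kato_deltaU μ (runFiltration N) (measurableSet_seqEvent (N := N) E) hN h0 h1
  have hL := fun E => kato_deltaL μ (runFiltration N) (measurableSet_seqEvent (N := N) E) hN h0 h1
  have hph := hL phaseErrorEvent estPh
  have hED := hU (errorEvent D) (estErr D)
  have hEV := hL (errorEvent .V) (estErr .V)
  have hCD := hU (crossEvent D) (estCross D)
  have hCV := hL (crossEvent .V) (estCross .V)
  simp only [countOf_phaseErrorEvent, countOf_errorEvent, countOf_crossEvent] at hph hED hEV hCD hCV
  rw [← runMeasure_apply]
  -- Union bound: up to a null set, failure of the final bound forces failure of one of the five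
  -- deviation bounds.
  refine (measure_mono_ae (t := _ ∪ (_ ∪ (_ ∪ (_ ∪ _)))) ?_).trans
    ((measure_union_le _ _).trans (add_le_add hph ((measure_union_le _ _).trans
      (add_le_add hED ((measure_union_le _ _).trans (add_le_add hEV
        ((measure_union_le _ _).trans (add_le_add hCD hCV)))))))) |>.trans (le_of_eq ?_)
  · filter_upwards [sum_condProb_phaseErrorEvent_le P V] with r hr hfail
    by_contra hcon
    obtain ⟨g1, hcon⟩ := not_or.1 hcon
    obtain ⟨g2, hcon⟩ := not_or.1 hcon
    obtain ⟨g3, hcon⟩ := not_or.1 hcon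
    obtain ⟨g4, g5⟩ := not_or.1 hcon
    exact absurd hfail (not_lt.2 (numPh_le_nPhUpper P hN (f := fun E => S E r) hr (not_lt.1 g1)
      (not_lt.1 g2) (not_lt.1 g3) (not_lt.1 g4) (not_lt.1 g5)))
  · rw [← ENNReal.ofReal_add h0.le h0.le, ← ENNReal.ofReal_add h0.le (by positivity),
      ← ENNReal.ofReal_add h0.le (by positivity), ← ENNReal.ofReal_add h0.le (by positivity)]
    congr 1
    ring

end bound

end PassiveBB84

end

theorem theorem1 (P : PassiveBB84.Params) {N : ℕ} (hN : 0 < N)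
    {K : Type*} [NormedAddCommGroup K] [InnerProductSpace ℂ K] [CompleteSpace K]
    (attack : PassiveBB84.Attack N K)
    (ε : ℝ) (hε0 : 0 < ε) (hε1 : ε < 1)
    (estPh : ℝ) (hPh : estPh ∈ Set.Icc (0 : ℝ) N)
    (estErr estCross : PassiveBB84.Intensity → ℝ)
    (hErr : ∀ ω, estErr ω ∈ Set.Icc (0 : ℝ) N) (hCross : ∀ ω, estCross ω ∈ Set.Icc (0 : ℝ) N) :
    0 ≤ P.c₁ ∧ 0 ≤ P.c₂ ∧
    (PassiveBB84.law P attack).toOuterMeasure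
        {r | PassiveBB84.nPhUpper P N ε estPh estErr estCross
            (PassiveBB84.numErrorX r) (PassiveBB84.numCross r) < (PassiveBB84.numPh 1 r : ℝ)} ≤
      ENNReal.ofReal (5 * ε) ∧
    (√(N : ℝ) / 2 ≤ PassiveBB84.aL N estPh ε → ∀ r : PassiveBB84.Run N,
      PassiveBB84.nPhUpper P N ε estPh estErr estCross
          (PassiveBB84.numErrorX r) (PassiveBB84.numCross r) = N ∧
        PassiveBB84.numPh 1 r ≤ N) ∧
    (PassiveBB84.aL N estPh ε < √(N : ℝ) / 2 → ∀ err cross : PassiveBB84.Intensity → ℕ,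
      PassiveBB84.nPhUpper P N ε estPh estErr estCross err cross -
          PassiveBB84.nPhUpperActive P N ε estPh estErr err =
        (1 - 2 * PassiveBB84.aL N estPh ε / √(N : ℝ))⁻¹ *
          (P.pPhotonAvg 1 / P.mu PassiveBB84.Intensity.D *
            (P.c₂ * PassiveBB84.decoyTerm P N ε estCross cross))) := by
  refine ⟨P.c₁_nonneg, P.c₂_nonneg,
    PassiveBB84.nPhUpper_failure_le P hN attack hε0 hε1 estPh estErr estCross, ?_, ?_⟩
  · intro h r
    exact ⟨if_neg (not_lt.2 h), PassiveBB84.numPh_le 1 r⟩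
  · intro h err cross
    rw [PassiveBB84.nPhUpper, PassiveBB84.nPhUpperActive, if_pos h, if_pos h]
    ring
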